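/- Let $\mathbb{k}$ be $\mathbb{R}$ or $\mathbb{C}$. All spaces below are compact Hausdorff, "vector bundle" means locally trivial $\mathbb{k}$-vector bundle of finite rank (the rank may differ between components), and $\varepsilon^n$ is the trivial bundle of rank $n$. Let $\widetilde K(X)$ be the set of classes of vector bundles over $X$ under the relation $E\sim F$ if and only if $E\oplus\varepsilon^n\cong F\oplus\varepsilon^m$ for some $n,m\ge 0$, with addition induced by $\oplus$; a map $f:Y\to X$ induces $f^*:\widetilde K(X)\to\widetilde K(Y)$ by pullback. For a nonempty closed $A\subset X$ let $X/A$ be the quotient space in which $A$ is collapsed to a point, $q:X\to X/A$ the quotient map, $i:A\to X$ the inclusion, $S$ the unreduced suspension, and $X\cup CA$ the space obtained from $X$ by attaching the cone on $A$; let $p:X\cup CA\to X/A$ collapse $CA$ and let $r:X\cup CA\to SA$ collapse $X$. Then: (0) For every compact Hausdorff space $Z$, $\widetilde K(Z)$ is an abelian group. (1) If $A\subset X$ is closed and contractible, then $q^*:\mathrm{Vect}^n(X/A)\to\mathrm{Vect}^n(X)$ is a bijection for every $n\ge 0$, where $\mathrm{Vect}^n$ denotes the set of isomorphism classes of $n$-dimensional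 vector bundles. (2) (Long exact sequence) Let $A\subset X$ be closed and nonempty. For every $n\ge0$ the map $(S^np)^*:\widetilde K(S^n(X/A))\to\widetilde K(S^n(X\cup CA))$ is bijective, and the homomorphisms $\delta_n:\widetilde K(S^{n+1}A)\to\widetilde K(S^n(X/A))$ determined by $(S^np)^*\circ\delta_n=(S^nr)^*$ fit, together with $(S^nq)^*$ and $(S^ni)^*$, into a long exact sequence $$\cdots\to\widetilde K(S(X/A))\xrightarrow{(Sq)^*}\widetilde K(SX)\xrightarrow{(Si)^*}\widetilde K(SA)\xrightarrow{\delta_0}\widetilde K(X/A)\xrightarrow{q^*}\widetilde K(X)\xrightarrow{i^*}\widetilde K(A);$$ that is, for every $n\ge 0$ it is exact at $\widetilde K(S^nX)$, at $\widetilde K(S^n(X/A))$ and at $\widetilde K(S^{n+1}A)$. (3) For spaces $A,B$ with basepoints, the restrictions to $A$ and $B$ give an isomorphism $\widetilde K(A\vee B)\cong\widetilde K(A)\oplus\widetilde K(B)$. (4) For spaces $X,Y$ with basepoints $x_0,y_0$, let $X\wedge Y=(X\times Y)/(X\times\{y_0\}\cup\{x_0\}\times Y)$, with quotient map $\pi:X\times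 Y\to X\wedge Y$ and projections $p_1,p_2$ of $X\times Y$ onto $X$ and $Y$. Then $(c,a,b)\mapsto \pi^*c+p_1^*a+p_2^*b$ is an isomorphism $\widetilde K(X\wedge Y)\oplus\widetilde K(X)\oplus\widetilde K(Y)\cong\widetilde K(X\times Y)$. -/

import Mathlib

universe u v w

namespace KTheory

noncomputable section

/-! ### Vector bundles -/

theorem continuous_of_induced {R S T : Type*} [TopologicalSpace R] [TopologicalSpace S]
    (f : T → S) {g : S → R} {h : T → R} (hg : Continuous g) (hh : ∀ t, h t = g (f t)) :
    @Continuous T R (TopologicalSpace.induced f inferInstance) inferInstance h := by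
  obtain rfl : h = g ∘ f := funext hh
  exact @Continuous.comp _ _ _ (_) _ _ _ _ hg continuous_induced_dom

/-- The total space of a family of sets: its points are the pairs `⟨x, e⟩` with `e` in the fiber
over `x`. -/
@[ext]
structure Total {X : Type u} (fiber : X → Type) : Type u where
  base : X
  vec : fiber base

/-- A family of `𝕜`-vector spaces over `X`: a vector space `fiber x` for every point `x`, and a
topology on the total space for which the projection to `X` is continuous. -/
structure Family (𝕜 : Type) [RCLike 𝕜] (X : Type u) [TopologicalSpace X] where
  fiber : X → Type
  [addCommGroup : ∀ x, AddCommGroup (fiber x)]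
  [module : ∀ x, Module 𝕜 (fiber x)]
  [top : TopologicalSpace (Total fiber)]
  continuous_proj : Continuous (Total.base : Total fiber → X)

namespace Family

variable {𝕜 : Type} [RCLike 𝕜] {X : Type u} [TopologicalSpace X] {Y : Type v} [TopologicalSpace Y]
  {Z : Type w} [TopologicalSpace Z]

instance (E : Family 𝕜 X) (x : X) : AddCommGroup (E.fiber x) := E.addCommGroup x

instance (E : Family 𝕜 X) (x : X) : Module 𝕜 (E.fiber x) := E.module x

instance (E : Family 𝕜 X) : TopologicalSpace (Total E.fiber) := E.top

/-- An isomorphism of families over `X`: linear isomorphisms of the fibers which together form a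
homeomorphism of the total spaces. -/
structure Iso (E F : Family 𝕜 X) where
  equiv : ∀ x, E.fiber x ≃ₗ[𝕜] F.fiber x
  continuous_toFun :
    Continuous (fun z : Total E.fiber => (⟨z.base, equiv z.base z.vec⟩ : Total F.fiber))
  continuous_invFun :
    Continuous (fun z : Total F.fiber => (⟨z.base, (equiv z.base).symm z.vec⟩ : Total E.fiber))

/-- The product family `X × 𝕜ⁿ`. -/
def trivial (𝕜 : Type) [RCLike 𝕜] (X : Type u) [TopologicalSpace X] (n : ℕ) : Family 𝕜 X where
  fiber _ := Fin n → 𝕜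
  top := TopologicalSpace.induced (fun z => ((z.base, z.vec) : X × (Fin n → 𝕜))) inferInstance
  continuous_proj := continuous_of_induced _ continuous_fst fun _ => rfl

/-- The pullback of a family along a continuous map `f : Y → X`. Its total space has the topology
of the subspace `{(y, e) | f y = p e}` of `Y × E`. -/
def pullback (f : C(Y, X)) (E : Family 𝕜 X) : Family 𝕜 Y where
  fiber y := E.fiber (f y)
  top := TopologicalSpace.induced
    (fun z => ((z.base, (⟨f z.base, z.vec⟩ : Total E.fiber)) : Y × (Total E.fiber))) inferInstance
  continuous_proj := continuous_of_induced _ continuous_fst fun _ => rfl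

/-- The direct sum of two families. Its total space has the topology of the fiber product, a
subspace of `E × F`. -/
def sum (E F : Family 𝕜 X) : Family 𝕜 X where
  fiber x := E.fiber x × F.fiber x
  top := TopologicalSpace.induced
    (fun z => (((⟨z.base, z.vec.1⟩ : Total E.fiber), (⟨z.base, z.vec.2⟩ : Total F.fiber)) :
      (Total E.fiber) × (Total F.fiber)))
    inferInstance
  continuous_proj := continuous_of_induced _
    (E.continuous_proj.comp continuous_fst) fun _ => rfl

/-- The restriction of a family to a subspace. -/
def restrict (E : Family 𝕜 X) (U : Set X) : Family 𝕜 U :=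
  E.pullback ⟨Subtype.val, continuous_subtype_val⟩

/-- Every point has an open neighbourhood `U` and an `n` such that the restriction to `U` is
isomorphic to `U × 𝕜ⁿ`. The number `n` may depend on the point. -/
def IsLocallyTrivial (E : Family 𝕜 X) : Prop :=
  ∀ x : X, ∃ U : Set X, IsOpen U ∧ x ∈ U ∧
    ∃ n : ℕ, Nonempty (Iso (E.restrict U) (trivial 𝕜 U n))

/-! Continuity criteria for maps into the constructions above. -/

theorem continuous_trivial {T : Type*} [TopologicalSpace T] {n : ℕ}
    {g : T → (Total (trivial 𝕜 X n).fiber)} :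
    Continuous g ↔ Continuous (fun t => (g t).base) ∧
      Continuous (fun t => ((g t).vec : Fin n → 𝕜)) :=
  continuous_induced_rng.trans continuous_prodMk

theorem continuous_pullback {T : Type*} [TopologicalSpace T] {f : C(Y, X)} {E : Family 𝕜 X}
    {g : T → (Total (E.pullback f).fiber)} :
    Continuous g ↔ Continuous (fun t => (g t).base) ∧
      Continuous (fun t => (⟨f (g t).base, (g t).vec⟩ : Total E.fiber)) :=
  continuous_induced_rng.trans continuous_prodMk

theorem continuous_sum {T : Type*} [TopologicalSpace T] {E F : Family 𝕜 X}
    {g : T → (Total (E.sum F).fiber)} :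
    Continuous g ↔ Continuous (fun t => (⟨(g t).base, (g t).vec.1⟩ : Total E.fiber)) ∧
      Continuous (fun t => (⟨(g t).base, (g t).vec.2⟩ : Total F.fiber)) :=
  continuous_induced_rng.trans continuous_prodMk

theorem continuous_trivial_snd (n : ℕ) :
    Continuous (fun z : Total (trivial 𝕜 X n).fiber => (z.vec : Fin n → 𝕜)) :=
  (continuous_trivial.1 continuous_id).2

theorem continuous_pullback_lift (f : C(Y, X)) (E : Family 𝕜 X) :
    Continuous (fun z : Total (E.pullback f).fiber => (⟨f z.base, z.vec⟩ : Total E.fiber)) :=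
  (continuous_pullback.1 continuous_id).2

theorem continuous_sum_fst (E F : Family 𝕜 X) :
    Continuous (fun z : Total (E.sum F).fiber => (⟨z.base, z.vec.1⟩ : Total E.fiber)) :=
  (continuous_sum.1 continuous_id).1

theorem continuous_sum_snd (E F : Family 𝕜 X) :
    Continuous (fun z : Total (E.sum F).fiber => (⟨z.base, z.vec.2⟩ : Total F.fiber)) :=
  (continuous_sum.1 continuous_id).2

namespace Iso

def refl (E : Family 𝕜 X) : Iso E E where
  equiv _ := LinearEquiv.refl 𝕜 _
  continuous_toFun := continuous_id
  continuous_invFun := continuous_id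

def symm {E F : Family 𝕜 X} (a : Iso E F) : Iso F E where
  equiv x := (a.equiv x).symm
  continuous_toFun := a.continuous_invFun
  continuous_invFun := a.continuous_toFun

def trans {E F G : Family 𝕜 X} (a : Iso E F) (b : Iso F G) : Iso E G where
  equiv x := (a.equiv x).trans (b.equiv x)
  continuous_toFun := b.continuous_toFun.comp a.continuous_toFun
  continuous_invFun := a.continuous_invFun.comp b.continuous_invFun

def sum {E E' F F' : Family 𝕜 X} (a : Iso E E') (b : Iso F F') :
    Iso (E.sum F) (E'.sum F') where
  equiv x := (a.equiv x).prodCongr (b.equiv x)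
  continuous_toFun := continuous_sum.2
    ⟨a.continuous_toFun.comp (continuous_sum_fst E F),
      b.continuous_toFun.comp (continuous_sum_snd E F)⟩
  continuous_invFun := continuous_sum.2
    ⟨a.continuous_invFun.comp (continuous_sum_fst E' F'),
      b.continuous_invFun.comp (continuous_sum_snd E' F')⟩

def sumComm (E F : Family 𝕜 X) : Iso (E.sum F) (F.sum E) where
  equiv x := LinearEquiv.prodComm 𝕜 (E.fiber x) (F.fiber x)
  continuous_toFun := continuous_sum.2 ⟨continuous_sum_snd E F, continuous_sum_fst E F⟩
  continuous_invFun := continuous_sum.2 ⟨continuous_sum_snd F E, continuous_sum_fst F E⟩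

def sumAssoc (E F G : Family 𝕜 X) : Iso ((E.sum F).sum G) (E.sum (F.sum G)) where
  equiv x := LinearEquiv.prodAssoc 𝕜 (E.fiber x) (F.fiber x) (G.fiber x)
  continuous_toFun := continuous_sum.2
    ⟨(continuous_sum_fst E F).comp (continuous_sum_fst (E.sum F) G), continuous_sum.2
      ⟨(continuous_sum_snd E F).comp (continuous_sum_fst (E.sum F) G),
        continuous_sum_snd (E.sum F) G⟩⟩
  continuous_invFun := continuous_sum.2
    ⟨continuous_sum.2 ⟨continuous_sum_fst E (F.sum G),
      (continuous_sum_fst F G).comp (continuous_sum_snd E (F.sum G))⟩,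
      (continuous_sum_snd F G).comp (continuous_sum_snd E (F.sum G))⟩

/-- `(X × 𝕜ⁿ) ⊕ (X × 𝕜ᵐ) ≅ X × 𝕜ⁿ⁺ᵐ`. -/
def trivialSum (𝕜 : Type) [RCLike 𝕜] (X : Type u) [TopologicalSpace X] (n m : ℕ) :
    Iso ((trivial 𝕜 X n).sum (trivial 𝕜 X m)) (trivial 𝕜 X (n + m)) where
  equiv _ := (LinearEquiv.sumArrowLequivProdArrow (Fin n) (Fin m) 𝕜 𝕜).symm.trans
    (LinearEquiv.funCongrLeft 𝕜 𝕜 finSumFinEquiv.symm)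
  continuous_toFun := by
    have h₁ := (continuous_trivial_snd (𝕜 := 𝕜) (X := X) n).comp
      (continuous_sum_fst (trivial 𝕜 X n) (trivial 𝕜 X m))
    have h₂ := (continuous_trivial_snd (𝕜 := 𝕜) (X := X) m).comp
      (continuous_sum_snd (trivial 𝕜 X n) (trivial 𝕜 X m))
    refine continuous_trivial.2 ⟨continuous_proj _, ?_⟩
    exact (LinearMap.continuous_of_finiteDimensional (𝕜 := 𝕜)
      (((LinearEquiv.sumArrowLequivProdArrow (Fin n) (Fin m) 𝕜 𝕜).symm.trans
        (LinearEquiv.funCongrLeft 𝕜 𝕜 finSumFinEquiv.symm)).toLinearMap)).comp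
        (h₁.prodMk h₂)
  continuous_invFun := by
    have h := (LinearMap.continuous_of_finiteDimensional (𝕜 := 𝕜)
      (((LinearEquiv.sumArrowLequivProdArrow (Fin n) (Fin m) 𝕜 𝕜).symm.trans
        (LinearEquiv.funCongrLeft 𝕜 𝕜 finSumFinEquiv.symm)).symm.toLinearMap)).comp
        (continuous_trivial_snd (𝕜 := 𝕜) (X := X) (n + m))
    exact continuous_sum.2
      ⟨continuous_trivial.2 ⟨continuous_proj _, continuous_fst.comp h⟩,
        continuous_trivial.2 ⟨continuous_proj _, continuous_snd.comp h⟩⟩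

def pullback (f : C(Y, X)) {E F : Family 𝕜 X} (a : Iso E F) :
    Iso (E.pullback f) (F.pullback f) where
  equiv y := a.equiv (f y)
  continuous_toFun := continuous_pullback.2
    ⟨continuous_proj _, a.continuous_toFun.comp (continuous_pullback_lift f E)⟩
  continuous_invFun := continuous_pullback.2
    ⟨continuous_proj _, a.continuous_invFun.comp (continuous_pullback_lift f F)⟩

def pullbackSum (f : C(Y, X)) (E F : Family 𝕜 X) :
    Iso ((E.sum F).pullback f) ((E.pullback f).sum (F.pullback f)) where
  equiv _ := LinearEquiv.refl 𝕜 _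
  continuous_toFun := continuous_sum.2
    ⟨continuous_pullback.2 ⟨continuous_proj _,
      (continuous_sum_fst E F).comp (continuous_pullback_lift f (E.sum F))⟩,
      continuous_pullback.2 ⟨continuous_proj _,
        (continuous_sum_snd E F).comp (continuous_pullback_lift f (E.sum F))⟩⟩
  continuous_invFun := continuous_pullback.2
    ⟨continuous_proj _, continuous_sum.2
      ⟨(continuous_pullback_lift f E).comp (continuous_sum_fst (E.pullback f) (F.pullback f)),
        (continuous_pullback_lift f F).comp (continuous_sum_snd (E.pullback f) (F.pullback f))⟩⟩

def pullbackTrivial (𝕜 : Type) [RCLike 𝕜] (f : C(Y, X)) (n : ℕ) :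
    Iso ((trivial 𝕜 X n).pullback f) (trivial 𝕜 Y n) where
  equiv _ := LinearEquiv.refl 𝕜 _
  continuous_toFun := continuous_trivial.2
    ⟨continuous_proj _,
      (continuous_trivial_snd (X := X) n).comp (continuous_pullback_lift f (trivial 𝕜 X n))⟩
  continuous_invFun := continuous_pullback.2
    ⟨continuous_proj _, continuous_trivial.2
      ⟨f.continuous.comp (continuous_proj (trivial 𝕜 Y n)), continuous_trivial_snd n⟩⟩

def pullbackComp (f : C(Y, X)) (g : C(Z, Y)) (E : Family 𝕜 X) :
    Iso ((E.pullback f).pullback g) (E.pullback (f.comp g)) where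
  equiv _ := LinearEquiv.refl 𝕜 _
  continuous_toFun := continuous_pullback.2
    ⟨continuous_proj _, (continuous_pullback_lift f E).comp
      (continuous_pullback_lift g (E.pullback f))⟩
  continuous_invFun := continuous_pullback.2
    ⟨continuous_proj _, continuous_pullback.2
      ⟨g.continuous.comp (continuous_proj (E.pullback (f.comp g))),
        continuous_pullback_lift (f.comp g) E⟩⟩

end Iso

theorem isLocallyTrivial_trivial (n : ℕ) : (trivial 𝕜 X n).IsLocallyTrivial := fun _ =>
  ⟨Set.univ, isOpen_univ, Set.mem_univ _, n, ⟨Iso.pullbackTrivial 𝕜 _ n⟩⟩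

theorem IsLocallyTrivial.pullback {E : Family 𝕜 X} (hE : E.IsLocallyTrivial) (f : C(Y, X)) :
    (E.pullback f).IsLocallyTrivial := by
  intro y
  obtain ⟨U, hU, hy, n, ⟨a⟩⟩ := hE (f y)
  refine ⟨f ⁻¹' U, hU.preimage f.continuous, hy, n, ⟨?_⟩⟩
  let g : C(f ⁻¹' U, U) := ⟨fun z => ⟨f z.1, z.2⟩, by fun_prop⟩
  exact (Iso.pullbackComp f _ E).trans <| (Iso.pullbackComp _ g E).symm.trans <|
    (a.pullback g).trans (Iso.pullbackTrivial 𝕜 g n)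

theorem IsLocallyTrivial.sum {E F : Family 𝕜 X} (hE : E.IsLocallyTrivial)
    (hF : F.IsLocallyTrivial) : (E.sum F).IsLocallyTrivial := by
  intro x
  obtain ⟨U, hU, hxU, n, ⟨a⟩⟩ := hE x
  obtain ⟨V, hV, hxV, m, ⟨b⟩⟩ := hF x
  refine ⟨U ∩ V, hU.inter hV, ⟨hxU, hxV⟩, n + m, ⟨?_⟩⟩
  let g : C((U ∩ V : Set X), U) := ⟨fun z => ⟨z.1, z.2.1⟩, by fun_prop⟩
  let h : C((U ∩ V : Set X), V) := ⟨fun z => ⟨z.1, z.2.2⟩, by fun_prop⟩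
  have a' : Iso (E.restrict (U ∩ V)) (trivial 𝕜 _ n) :=
    (Iso.pullbackComp _ g E).symm.trans ((a.pullback g).trans (Iso.pullbackTrivial 𝕜 g n))
  have b' : Iso (F.restrict (U ∩ V)) (trivial 𝕜 _ m) :=
    (Iso.pullbackComp _ h F).symm.trans ((b.pullback h).trans (Iso.pullbackTrivial 𝕜 h m))
  exact (Iso.pullbackSum _ E F).trans ((a'.sum b').trans (Iso.trivialSum 𝕜 _ n m))

end Family

/-- A vector bundle over `X`: a locally trivial family of finite-dimensional vector spaces. The
dimension of the fibers is locally constant; it may differ between components of `X`. -/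
structure VectorBundle (𝕜 : Type) [RCLike 𝕜] (X : Type u) [TopologicalSpace X] extends
    Family 𝕜 X where
  isLocallyTrivial : toFamily.IsLocallyTrivial

section Bundles

variable {𝕜 : Type} [RCLike 𝕜] {X : Type u} [TopologicalSpace X] {Y : Type v} [TopologicalSpace Y]

namespace VectorBundle

/-- The trivial bundle `εⁿ` over `X`. -/
def trivial (𝕜 : Type) [RCLike 𝕜] (X : Type u) [TopologicalSpace X] (n : ℕ) :
    VectorBundle 𝕜 X :=
  ⟨Family.trivial 𝕜 X n, Family.isLocallyTrivial_trivial n⟩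

/-- The direct sum of vector bundles. -/
def sum (E F : VectorBundle 𝕜 X) : VectorBundle 𝕜 X :=
  ⟨E.toFamily.sum F.toFamily, E.isLocallyTrivial.sum F.isLocallyTrivial⟩

/-- The pullback of a vector bundle. -/
def pullback (f : C(Y, X)) (E : VectorBundle 𝕜 X) : VectorBundle 𝕜 Y :=
  ⟨E.toFamily.pullback f, E.isLocallyTrivial.pullback f⟩

/-- Isomorphism of vector bundles over `X`. -/
def IsIso (E F : VectorBundle 𝕜 X) : Prop := Nonempty (Family.Iso E.toFamily F.toFamily)

theorem IsIso.refl (E : VectorBundle 𝕜 X) : E.IsIso E := ⟨Family.Iso.refl _⟩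

theorem IsIso.symm {E F : VectorBundle 𝕜 X} : E.IsIso F → F.IsIso E := fun ⟨a⟩ => ⟨a.symm⟩

theorem IsIso.trans {E F G : VectorBundle 𝕜 X} : E.IsIso F → F.IsIso G → E.IsIso G :=
  fun ⟨a⟩ ⟨b⟩ => ⟨a.trans b⟩

theorem IsIso.sum {E E' F F' : VectorBundle 𝕜 X} :
    E.IsIso E' → F.IsIso F' → (E.sum F).IsIso (E'.sum F') :=
  fun ⟨a⟩ ⟨b⟩ => ⟨a.sum b⟩

theorem IsIso.pullback (f : C(Y, X)) {E F : VectorBundle 𝕜 X} :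
    E.IsIso F → (E.pullback f).IsIso (F.pullback f) :=
  fun ⟨a⟩ => ⟨a.pullback f⟩

theorem sum_comm (E F : VectorBundle 𝕜 X) : (E.sum F).IsIso (F.sum E) :=
  ⟨Family.Iso.sumComm _ _⟩

theorem sum_assoc (E F G : VectorBundle 𝕜 X) : ((E.sum F).sum G).IsIso (E.sum (F.sum G)) :=
  ⟨Family.Iso.sumAssoc _ _ _⟩

theorem sum_sum_sum_comm (E F G H : VectorBundle 𝕜 X) :
    ((E.sum F).sum (G.sum H)).IsIso ((E.sum G).sum (F.sum H)) :=
  (sum_assoc E F (G.sum H)).trans <|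
    ((IsIso.refl E).sum (((sum_assoc F G H).symm.trans
      (((sum_comm F G).sum (IsIso.refl H)).trans (sum_assoc G F H))))).trans
      (sum_assoc E G (F.sum H)).symm

theorem trivial_sum (n m : ℕ) :
    ((trivial 𝕜 X n).sum (trivial 𝕜 X m)).IsIso (trivial 𝕜 X (n + m)) :=
  ⟨Family.Iso.trivialSum 𝕜 X n m⟩

theorem pullback_sum (f : C(Y, X)) (E F : VectorBundle 𝕜 X) :
    ((E.sum F).pullback f).IsIso ((E.pullback f).sum (F.pullback f)) :=
  ⟨Family.Iso.pullbackSum f _ _⟩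

theorem pullback_trivial (f : C(Y, X)) (n : ℕ) :
    ((trivial 𝕜 X n).pullback f).IsIso (trivial 𝕜 Y n) :=
  ⟨Family.Iso.pullbackTrivial 𝕜 f n⟩

/-- The relation defining the reduced K-group: `E ⊕ εⁿ ≅ F ⊕ εᵐ` for some `n` and `m`. -/
def StablyEquiv (E F : VectorBundle 𝕜 X) : Prop :=
  ∃ n m : ℕ, (E.sum (trivial 𝕜 X n)).IsIso (F.sum (trivial 𝕜 X m))

theorem IsIso.stablyEquiv {E F : VectorBundle 𝕜 X} (h : E.IsIso F) : E.StablyEquiv F :=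
  ⟨0, 0, h.sum (IsIso.refl _)⟩

theorem StablyEquiv.symm {E F : VectorBundle 𝕜 X} : E.StablyEquiv F → F.StablyEquiv E :=
  fun ⟨n, m, h⟩ => ⟨m, n, h.symm⟩

theorem sum_trivial_sum_trivial (E : VectorBundle 𝕜 X) (n m : ℕ) :
    ((E.sum (trivial 𝕜 X n)).sum (trivial 𝕜 X m)).IsIso (E.sum (trivial 𝕜 X (n + m))) :=
  (sum_assoc _ _ _).trans ((IsIso.refl E).sum (trivial_sum n m))

theorem StablyEquiv.trans {E F G : VectorBundle 𝕜 X} :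
    E.StablyEquiv F → F.StablyEquiv G → E.StablyEquiv G := by
  rintro ⟨n, m, a⟩ ⟨k, l, b⟩
  refine ⟨n + k, l + m, ?_⟩
  have h₁ := a.sum (IsIso.refl (trivial 𝕜 X k))
  have h₂ := b.sum (IsIso.refl (trivial 𝕜 X m))
  have h₃ := (sum_trivial_sum_trivial E n k).symm.trans
    (h₁.trans (sum_trivial_sum_trivial F m k))
  have h₄ := (sum_trivial_sum_trivial F k m).symm.trans
    (h₂.trans (sum_trivial_sum_trivial G l m))
  rw [add_comm k m] at h₄
  exact h₃.trans h₄

theorem StablyEquiv.sum {E E' F F' : VectorBundle 𝕜 X} :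
    E.StablyEquiv E' → F.StablyEquiv F' → (E.sum F).StablyEquiv (E'.sum F') := by
  rintro ⟨n, m, a⟩ ⟨k, l, b⟩
  refine ⟨n + k, m + l, ?_⟩
  exact ((IsIso.refl _).sum (trivial_sum n k).symm).trans <|
    (sum_sum_sum_comm _ _ _ _).trans <| (a.sum b).trans <|
    (sum_sum_sum_comm _ _ _ _).trans ((IsIso.refl _).sum (trivial_sum m l))

theorem StablyEquiv.pullback (f : C(Y, X)) {E F : VectorBundle 𝕜 X} :
    E.StablyEquiv F → (E.pullback f).StablyEquiv (F.pullback f) := by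
  rintro ⟨n, m, a⟩
  refine ⟨n, m, ?_⟩
  exact ((IsIso.refl _).sum (pullback_trivial f n).symm).trans <|
    (pullback_sum f _ _).symm.trans <| (a.pullback f).trans <|
    (pullback_sum f _ _).trans ((IsIso.refl _).sum (pullback_trivial f m))

theorem trivial_stablyEquiv (n m : ℕ) : (trivial 𝕜 X n).StablyEquiv (trivial 𝕜 X m) :=
  ⟨m, n, (trivial_sum n m).trans (by rw [add_comm n m]; exact (trivial_sum m n).symm)⟩

end VectorBundle

/-! ### The sets `Vectⁿ` and the reduced K-group -/

/-- Isomorphism of `n`-dimensional vector bundles over `X`. -/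
def vectSetoid (𝕜 : Type) [RCLike 𝕜] (n : ℕ) (X : Type u) [TopologicalSpace X] :
    Setoid {E : VectorBundle 𝕜 X // ∀ x, Module.finrank 𝕜 (E.fiber x) = n} where
  r E F := E.1.IsIso F.1
  iseqv := ⟨fun _ => .refl _, .symm, .trans⟩

/-- `Vectⁿ(X)`: the isomorphism classes of `n`-dimensional vector bundles over `X`. -/
def Vect (𝕜 : Type) [RCLike 𝕜] (n : ℕ) (X : Type u) [TopologicalSpace X] : Type (max u 1) :=
  Quotient (vectSetoid 𝕜 n X)

/-- The map `f^* : Vectⁿ(X) → Vectⁿ(Y)` induced by `f : Y → X`. -/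
def Vect.map (𝕜 : Type) [RCLike 𝕜] (n : ℕ) (f : C(Y, X)) : Vect 𝕜 n X → Vect 𝕜 n Y :=
  Quotient.map (fun E => ⟨E.1.pullback f, fun y => E.2 (f y)⟩)
    (fun _ _ h => VectorBundle.IsIso.pullback f h)

/-- The relation of stable equivalence on vector bundles. -/
def stableSetoid (𝕜 : Type) [RCLike 𝕜] (X : Type u) [TopologicalSpace X] :
    Setoid (VectorBundle 𝕜 X) where
  r := VectorBundle.StablyEquiv
  iseqv := ⟨fun E => (VectorBundle.IsIso.refl E).stablyEquiv, .symm, .trans⟩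

/-- The reduced K-group of `X`: stable classes of vector bundles over `X` under direct sum.
For a general space this is a commutative monoid; for compact Hausdorff `X` it is a group. -/
def RedK (𝕜 : Type) [RCLike 𝕜] (X : Type u) [TopologicalSpace X] : Type (max u 1) :=
  Quotient (stableSetoid 𝕜 X)

/-- The stable class of a vector bundle. -/
def RedK.mk (E : VectorBundle 𝕜 X) : RedK 𝕜 X := Quotient.mk (stableSetoid 𝕜 X) E

/-- Addition is induced by the direct sum, and zero is the class of a trivial bundle. -/
instance : Add (RedK 𝕜 X) :=
  ⟨Quotient.map₂ VectorBundle.sum (fun _ _ h _ _ h' => VectorBundle.StablyEquiv.sum h h')⟩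

instance : Zero (RedK 𝕜 X) := ⟨RedK.mk (VectorBundle.trivial 𝕜 X 0)⟩

instance : AddCommMonoid (RedK 𝕜 X) where
  nsmul := nsmulRec
  add_assoc := by
    rintro ⟨E⟩ ⟨F⟩ ⟨G⟩
    exact Quotient.sound (s := stableSetoid 𝕜 X) (VectorBundle.sum_assoc E F G).stablyEquiv
  add_comm := by
    rintro ⟨E⟩ ⟨F⟩
    exact Quotient.sound (s := stableSetoid 𝕜 X) (VectorBundle.sum_comm E F).stablyEquiv
  zero_add := by
    rintro ⟨E⟩
    refine Quotient.sound (s := stableSetoid 𝕜 X) ?_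
    exact (VectorBundle.sum_comm _ E).stablyEquiv.trans
      ⟨0, 0, VectorBundle.sum_trivial_sum_trivial E 0 0⟩
  add_zero := by
    rintro ⟨E⟩
    exact Quotient.sound (s := stableSetoid 𝕜 X)
      ⟨0, 0, VectorBundle.sum_trivial_sum_trivial E 0 0⟩

/-- The homomorphism `f^* : K̃(X) → K̃(Y)` induced by `f : Y → X`. -/
def RedK.map (𝕜 : Type) [RCLike 𝕜] (f : C(Y, X)) : RedK 𝕜 X →+ RedK 𝕜 Y where
  toFun := Quotient.map (VectorBundle.pullback f)
    (fun _ _ h => VectorBundle.StablyEquiv.pullback f h)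
  map_zero' := Quotient.sound (s := stableSetoid 𝕜 Y)
    (VectorBundle.pullback_trivial f 0).stablyEquiv
  map_add' := by
    rintro ⟨E⟩ ⟨F⟩
    exact Quotient.sound (s := stableSetoid 𝕜 Y) (VectorBundle.pullback_sum f E F).stablyEquiv

end Bundles

/-! ### Constructions on spaces -/

section Spaces

variable {X : Type u} [TopologicalSpace X] {Y : Type v} [TopologicalSpace Y]

/-- The inclusion of a subspace. -/
def incl (A : Set X) : C(A, X) := ⟨Subtype.val, continuous_subtype_val⟩

/-- The equivalence relation that identifies all points of `A` with each other. -/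
def collapseSetoid (A : Set X) : Setoid X where
  r x y := x = y ∨ (x ∈ A ∧ y ∈ A)
  iseqv := ⟨fun _ => .inl rfl, by grind, by grind⟩

/-- The quotient space `X / A`. -/
def Collapse (A : Set X) : Type u := Quotient (collapseSetoid A)

instance (A : Set X) : TopologicalSpace (Collapse A) :=
  inferInstanceAs (TopologicalSpace (Quotient (collapseSetoid A)))

/-- The quotient map `X → X / A`. -/
def Collapse.mk (A : Set X) : C(X, Collapse A) := ⟨Quotient.mk _, continuous_quotient_mk'⟩

theorem Collapse.mk_eq {A : Set X} {x y : X} (h : x = y ∨ (x ∈ A ∧ y ∈ A)) :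
    Collapse.mk A x = Collapse.mk A y :=
  Quotient.sound (s := collapseSetoid A) h

/-- The relation on `X × [0, 1]` that identifies `X × {0}` to a point and `X × {1}` to a point. -/
def suspSetoid (X : Type u) : Setoid (X × unitInterval) where
  r p q := p = q ∨ (p.2 = 0 ∧ q.2 = 0) ∨ (p.2 = 1 ∧ q.2 = 1)
  iseqv := ⟨fun _ => .inl rfl, by grind, by
    have h01 : (0 : unitInterval) ≠ 1 := zero_ne_one
    grind⟩

/-- The (unreduced) suspension `SX`. -/
def Susp (X : Type u) : Type u := Quotient (suspSetoid X)

instance : TopologicalSpace (Susp X) :=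
  inferInstanceAs (TopologicalSpace (Quotient (suspSetoid X)))

/-- The quotient map `X × [0, 1] → SX`. -/
def Susp.mk (X : Type u) [TopologicalSpace X] : C(X × unitInterval, Susp X) :=
  ⟨Quotient.mk _, continuous_quotient_mk'⟩

theorem Susp.mk_eq {p q : X × unitInterval}
    (h : p = q ∨ (p.2 = 0 ∧ q.2 = 0) ∨ (p.2 = 1 ∧ q.2 = 1)) : Susp.mk X p = Susp.mk X q :=
  Quotient.sound (s := suspSetoid X) h

/-- The map `Sf : SX → SY` induced by `f : X → Y`. -/
def Susp.map (f : C(X, Y)) : C(Susp X, Susp Y) where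
  toFun := Quotient.map (fun p => (f p.1, p.2)) (by
    rintro p q (h | h | h)
    · exact .inl (by rw [h])
    · exact .inr (.inl h)
    · exact .inr (.inr h))
  continuous_toFun := Continuous.quotient_map' (by fun_prop) _

/-- The iterated suspension `SⁿX`, with `Sⁿ⁺¹X = Sⁿ(SX)`. -/
def IterSusp : (n : ℕ) → (X : Type u) → Type u
  | 0, X => X
  | n + 1, X => IterSusp n (Susp X)

instance IterSusp.instTopologicalSpace :
    (n : ℕ) → (X : Type u) → [TopologicalSpace X] → TopologicalSpace (IterSusp n X)
  | 0, _, h => h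
  | n + 1, X, _ => IterSusp.instTopologicalSpace n (Susp X)

/-- The map `Sⁿf : SⁿX → SⁿY` induced by `f : X → Y`. -/
def IterSusp.map : (n : ℕ) → {X : Type u} → [TopologicalSpace X] → {Y : Type v} →
    [TopologicalSpace Y] → C(X, Y) → C(IterSusp n X, IterSusp n Y)
  | 0, _, _, _, _, f => f
  | n + 1, _, _, _, _, f => IterSusp.map n (Susp.map f)

/-- The map from the disjoint union of `X` and `A × [0, 1]` to `X × [0, 1]` that sends `x` to
`(x, 0)` and is the inclusion on `A × [0, 1]`. -/
def coneAux (A : Set X) : X ⊕ (A × unitInterval) → X × unitInterval :=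
  Sum.elim (fun x => (x, 0)) (fun p => (p.1.1, p.2))

/-- The relation on the disjoint union of `X` and `A × [0, 1]` that glues `(a, 0)` to `a` for all
`a` in `A` and identifies `A × {1}` to a point. -/
def coneSetoid (A : Set X) : Setoid (X ⊕ (A × unitInterval)) :=
  (collapseSetoid {p : X × unitInterval | p.2 = 1}).comap (coneAux A)

/-- The space `X ∪ CA` obtained from `X` by attaching a cone on `A`. -/
def ConeAttach (A : Set X) : Type u := Quotient (coneSetoid A)

instance (A : Set X) : TopologicalSpace (ConeAttach A) :=
  inferInstanceAs (TopologicalSpace (Quotient (coneSetoid A)))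

/-- The map `X ∪ CA → X / A` that collapses the cone `CA` to a point. -/
def ConeAttach.toCollapse (A : Set X) : C(ConeAttach A, Collapse A) where
  toFun := Quotient.lift
    (Sum.elim (fun x => Collapse.mk A x) (fun p => Collapse.mk A p.1.1)) (by
      have h01 : (0 : unitInterval) ≠ 1 := zero_ne_one
      rintro (x | ⟨⟨a, ha⟩, s⟩) (y | ⟨⟨b, hb⟩, t⟩) (h | ⟨h, h'⟩) <;>
        refine Collapse.mk_eq ?_ <;> simp_all [coneAux])
  continuous_toFun := Continuous.quotient_lift (by fun_prop) _

/-- The map `X ∪ CA → SA` that collapses `X` to a point: it is induced by the identity of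
`A × [0, 1]` and sends `X` to the pole `A × {0}`. -/
def ConeAttach.toSusp (A : Set X) [Nonempty A] : C(ConeAttach A, Susp A) where
  toFun := Quotient.lift
    (Sum.elim (fun _ => Susp.mk A (Classical.arbitrary A, 0)) (fun p => Susp.mk A p)) (by
      have h01 : (0 : unitInterval) ≠ 1 := zero_ne_one
      rintro (x | ⟨⟨a, ha⟩, s⟩) (y | ⟨⟨b, hb⟩, t⟩) (h | ⟨h, h'⟩) <;>
        refine Susp.mk_eq ?_ <;> simp_all [coneAux])
  continuous_toFun := Continuous.quotient_lift (by fun_prop) _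

/-- The wedge sum: the disjoint union of `X` and `Y` with `x₀` and `y₀` identified. -/
abbrev Wedge (x₀ : X) (y₀ : Y) : Type (max u v) :=
  Collapse ({Sum.inl x₀, Sum.inr y₀} : Set (X ⊕ Y))

/-- The inclusion `X → X ∨ Y`. -/
def Wedge.inl (x₀ : X) (y₀ : Y) : C(X, Wedge x₀ y₀) :=
  (Collapse.mk _).comp ⟨Sum.inl, continuous_inl⟩

/-- The inclusion `Y → X ∨ Y`. -/
def Wedge.inr (x₀ : X) (y₀ : Y) : C(Y, Wedge x₀ y₀) :=
  (Collapse.mk _).comp ⟨Sum.inr, continuous_inr⟩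

/-- The smash product: the quotient of `X × Y` by `X × {y₀} ∪ {x₀} × Y`. -/
abbrev Smash (x₀ : X) (y₀ : Y) : Type (max u v) :=
  Collapse {p : X × Y | p.2 = y₀ ∨ p.1 = x₀}

/-- The quotient map `X × Y → X ∧ Y`. -/
def Smash.mk (x₀ : X) (y₀ : Y) : C(X × Y, Smash x₀ y₀) := Collapse.mk _

/-! The spaces above are compact Hausdorff when the given ones are. -/

theorem t2Space_quotient {X : Type u} [TopologicalSpace X] [CompactSpace X] [T2Space X]
    (s : Setoid X) (hs : IsClosed {p : X × X | s p.1 p.2}) : T2Space (Quotient s) := by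
  have hmk : ∀ x y : X, (Quotient.mk s x = Quotient.mk s y) ↔ s x y := fun x y => Quotient.eq
  have hclosed : ∀ C : Set X, IsClosed C → IsClosed (Quotient.mk s '' C) := by
    intro C hC
    refine isQuotientMap_quotient_mk'.isClosed_preimage.1 ?_
    have h : (Quotient.mk s) ⁻¹' (Quotient.mk s '' C)
        = Prod.snd '' ((Prod.fst ⁻¹' C) ∩ {p : X × X | s p.1 p.2}) := by
      ext y
      constructor
      · rintro ⟨x, hx, hxy⟩
        exact ⟨(x, y), ⟨hx, (hmk x y).1 hxy⟩, rfl⟩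
      · rintro ⟨⟨x, z⟩, ⟨hx, hxz⟩, rfl⟩
        exact ⟨x, hx, (hmk _ _).2 hxz⟩
    exact h ▸ (((hC.preimage continuous_fst).inter hs).isCompact.image continuous_snd).isClosed
  refine ⟨fun a b hab => ?_⟩
  have hfib : ∀ c : Quotient s, IsClosed (Quotient.mk s ⁻¹' {c}) := by
    intro c
    obtain ⟨x, rfl⟩ := Quotient.exists_rep c
    have := hclosed {x} isClosed_singleton
    rw [Set.image_singleton] at this
    exact this.preimage continuous_quotient_mk'
  obtain ⟨U, V, hU, hV, haU, hbV, hUV⟩ := normal_separation (hfib a) (hfib b)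
    (Disjoint.preimage _ (Set.disjoint_singleton.2 hab))
  refine ⟨(Quotient.mk s '' Uᶜ)ᶜ, (Quotient.mk s '' Vᶜ)ᶜ,
    (hclosed _ hU.isClosed_compl).isOpen_compl, (hclosed _ hV.isClosed_compl).isOpen_compl,
    ?_, ?_, ?_⟩
  · rintro ⟨x, hx, rfl⟩
    exact hx (haU rfl)
  · rintro ⟨x, hx, rfl⟩
    exact hx (hbV rfl)
  · rw [Set.disjoint_left]
    intro c hc hc'
    obtain ⟨x, rfl⟩ := Quotient.exists_rep c
    have hxU : x ∈ U := by
      by_contra h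
      exact hc ⟨x, h, rfl⟩
    have hxV : x ∈ V := by
      by_contra h
      exact hc' ⟨x, h, rfl⟩
    exact Set.disjoint_left.1 hUV hxU hxV

instance [CompactSpace X] (A : Set X) : CompactSpace (Collapse A) :=
  inferInstanceAs (CompactSpace (Quotient (collapseSetoid A)))

instance [CompactSpace X] : CompactSpace (Susp X) :=
  inferInstanceAs (CompactSpace (Quotient (suspSetoid X)))

theorem isClosed_collapseSetoid [T2Space X] {A : Set X} (hA : IsClosed A) :
    IsClosed {p : X × X | collapseSetoid A p.1 p.2} :=
  (isClosed_eq continuous_fst continuous_snd).union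
    ((hA.preimage continuous_fst).inter (hA.preimage continuous_snd))

theorem Collapse.t2Space [CompactSpace X] [T2Space X] {A : Set X} (hA : IsClosed A) :
    T2Space (Collapse A) :=
  t2Space_quotient _ (isClosed_collapseSetoid hA)

instance [CompactSpace X] [T2Space X] : T2Space (Susp X) := by
  have h (c : unitInterval) : IsClosed {q : (X × unitInterval) × (X × unitInterval) |
      q.1.2 = c ∧ q.2.2 = c} :=
    (isClosed_eq (by fun_prop) continuous_const).inter (isClosed_eq (by fun_prop) continuous_const)
  exact t2Space_quotient (suspSetoid X)
    ((isClosed_eq continuous_fst continuous_snd).union ((h 0).union (h 1)))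

theorem ConeAttach.compactSpace [CompactSpace X] {A : Set X} (hA : IsClosed A) :
    CompactSpace (ConeAttach A) :=
  have : CompactSpace A := isCompact_iff_compactSpace.1 hA.isCompact
  inferInstanceAs (CompactSpace (Quotient (coneSetoid A)))

theorem ConeAttach.t2Space [CompactSpace X] [T2Space X] {A : Set X} (hA : IsClosed A) :
    T2Space (ConeAttach A) := by
  have : CompactSpace A := isCompact_iff_compactSpace.1 hA.isCompact
  have hc : Continuous (coneAux A) := by
    unfold coneAux
    fun_prop
  have hT : IsClosed {p : X × unitInterval | p.2 = 1} :=
    isClosed_eq continuous_snd continuous_const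
  exact t2Space_quotient (coneSetoid A)
    ((isClosed_collapseSetoid hT).preimage (hc.prodMap hc))

theorem IterSusp.compactSpace : (n : ℕ) → (X : Type u) → [TopologicalSpace X] →
    [CompactSpace X] → CompactSpace (IterSusp n X)
  | 0, _, _, h => h
  | n + 1, X, _, _ => IterSusp.compactSpace n (Susp X)

theorem IterSusp.t2Space : (n : ℕ) → (X : Type u) → [TopologicalSpace X] →
    [CompactSpace X] → [T2Space X] → T2Space (IterSusp n X)
  | 0, _, _, _, h => h
  | n + 1, X, _, _, _ => IterSusp.t2Space n (Susp X)

theorem Wedge.t2Space [CompactSpace X] [T2Space X] [CompactSpace Y] [T2Space Y]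
    (x₀ : X) (y₀ : Y) : T2Space (Wedge x₀ y₀) :=
  Collapse.t2Space (Set.toFinite _).isClosed

theorem Smash.t2Space [CompactSpace X] [T2Space X] [CompactSpace Y] [T2Space Y]
    (x₀ : X) (y₀ : Y) : T2Space (Smash x₀ y₀) :=
  Collapse.t2Space ((isClosed_eq continuous_snd continuous_const).union
    (isClosed_eq continuous_fst continuous_const))

end Spaces

end

end KTheory

/-! Over a compact Hausdorff space every bundle is a retract of a constant bundle `X × V` with `V`
finite-dimensional (`VectorBundle.exists_presentation`), so it is the image of a continuous family
of idempotents. Isomorphisms of bundles then become equivalences of idempotents (`IdemEquiv`): pairs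
of continuous operator-valued maps, which can be extended by Tietze's theorem, perturbed and passed
to quotients. The idempotent `1 - p` supplies additive inverses. Nearby idempotents are equivalent,
and connectedness of the interval turns this into homotopy invariance.

Two facts about collapsing a closed `A` in `Y` to a point carry the rest. A bundle that is trivial
on `A` comes from the quotient (`exists_isIso_pullback`): the trivialization, extended over `Y` as
mere matrices, conjugates `p ⊕ 0` to an idempotent that is constant on `A`. If `A` is contractible,
an isomorphism between two pullbacks can be changed until it is constant on `A`, and then it
descends (`isIso_of_isIso_pullback`). Together they prove (1); the first also makes K̃(Y/A) → K̃(Y)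
→ K̃(A) exact.

The long exact sequence is a Puppe sequence. Its three kinds of exactness come from the collapses X
→ X/A of A, X ∪ CA → SA of X, and CX ∪ CA → SX of X ∪ CA. Collapsing the contractible cone CA
identifies K̃(X ∪ CA) with K̃(X/A), and collapsing CX identifies K̃(CX ∪ CA) with K̃(SA); under the
latter, CX ∪ CA → SX becomes the suspended inclusion SA → SX up to homotopy (`toSusp_homotopic`).
Iterated suspensions of a point are contractible but need not be points, so `IsCollapse` allows a
collapse onto a larger center, and `exact_map` and `bijective_map` hold for contractible centers.

A wedge retracts onto both summands, which splits its group. For a product, every class on the union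
of the axes extends by the projections, and this persists after a suspension; hence the connecting
map into K̃(X ∧ Y) vanishes and the exact sequence splits. -/

namespace KTheory

noncomputable section

open Topology Filter

/-! ### Local charts of vector bundles -/

section Charts

variable {𝕜 : Type} [RCLike 𝕜] {X : Type u} [TopologicalSpace X]

/-- A local trivialization of a family near `x`, as two families of linear maps which are defined
everywhere but only meaningful over an open neighbourhood of `x`. -/
structure Family.Chart (E : Family 𝕜 X) (x : X) where
  source : Set X
  isOpen_source : IsOpen source
  mem_source : x ∈ source
  rank : ℕ
  toModel : ∀ y, E.fiber y →ₗ[𝕜] (Fin rank → 𝕜)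
  ofModel : ∀ y, (Fin rank → 𝕜) →ₗ[𝕜] E.fiber y
  of_to : ∀ y ∈ source, ∀ e, ofModel y (toModel y e) = e
  to_of : ∀ y ∈ source, ∀ e, toModel y (ofModel y e) = e
  continuousOn_to : ContinuousOn (fun z : Total E.fiber => toModel z.base z.vec)
    (Total.base ⁻¹' source)
  continuousOn_of : ContinuousOn
    (fun w : X × (Fin rank → 𝕜) => (⟨w.1, ofModel w.1 w.2⟩ : Total E.fiber)) (Prod.fst ⁻¹' source)

/-- Extending the trivialization by zero outside `U` removes the subtype `U` from all later
arguments. Nothing is lost, since continuity and the inverse relations are claimed only over `U`. -/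
theorem Family.IsLocallyTrivial.exists_chart {E : Family 𝕜 X} (hE : E.IsLocallyTrivial) (x : X) :
    Nonempty (E.Chart x) := by
  classical
  obtain ⟨U, hU, hx, n, ⟨a⟩⟩ := hE x
  let φ : ∀ y, E.fiber y →ₗ[𝕜] (Fin n → 𝕜) := fun y =>
    if h : y ∈ U then ((a.equiv ⟨y, h⟩).toLinearMap : E.fiber y →ₗ[𝕜] (Fin n → 𝕜)) else 0
  let ψ : ∀ y, (Fin n → 𝕜) →ₗ[𝕜] E.fiber y := fun y =>
    if h : y ∈ U then ((a.equiv ⟨y, h⟩).symm.toLinearMap : (Fin n → 𝕜) →ₗ[𝕜] E.fiber y) else 0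
  have hφ : ∀ y (h : y ∈ U) e, φ y e = a.equiv ⟨y, h⟩ e := fun y h e => 
    congrArg (fun l : E.fiber y →ₗ[𝕜] (Fin n → 𝕜) => l e) (dif_pos h)
  have hψ : ∀ y (h : y ∈ U) e, ψ y e = (a.equiv ⟨y, h⟩).symm e := fun y h e => 
    congrArg (fun l : (Fin n → 𝕜) →ₗ[𝕜] E.fiber y => l e) (dif_pos h)
  refine ⟨⟨U, hU, hx, n, φ, ψ, fun y hy e => ?_, fun y hy e => ?_, ?_, ?_⟩⟩
  · exact (hψ y hy _).trans ((congrArg _ (hφ y hy e)).trans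
      ((a.equiv ⟨y, hy⟩).symm_apply_apply e))
  · exact (hφ y hy _).trans ((congrArg _ (hψ y hy e)).trans
      ((a.equiv ⟨y, hy⟩).apply_symm_apply e))
  · rw [continuousOn_iff_continuous_domRestrict]
    let g : (Total.base ⁻¹' U : Set (Total E.fiber)) → Total (E.restrict U).fiber :=
      fun z => ⟨⟨z.1.base, z.2⟩, z.1.vec⟩
    have hg : Continuous g := Family.continuous_pullback.2
      ⟨(E.continuous_proj.comp continuous_subtype_val).subtype_mk _, continuous_subtype_val⟩
    refine ((Family.continuous_trivial_snd n).comp (a.continuous_toFun.comp hg)).congr ?_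
    rintro ⟨z, hz⟩
    exact (hφ z.base hz z.vec).symm
  · rw [continuousOn_iff_continuous_domRestrict]
    let g : (Prod.fst ⁻¹' U : Set (X × (Fin n → 𝕜))) → Total (Family.trivial 𝕜 U n).fiber :=
      fun z => ⟨⟨z.1.1, z.2⟩, z.1.2⟩
    have hg : Continuous g := Family.continuous_trivial.2
      ⟨(continuous_fst.comp continuous_subtype_val).subtype_mk _,
        continuous_snd.comp continuous_subtype_val⟩
    refine ((Family.continuous_pullback_lift _ E).comp (a.continuous_invFun.comp hg)).congr ?_
    rintro ⟨w, hw⟩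
    exact congrArg (fun e => (⟨w.1, e⟩ : Total E.fiber)) (hψ w.1 hw w.2).symm

namespace Family.Chart

variable {E : Family 𝕜 X} {x : X} {T : Type*} [TopologicalSpace T]

theorem continuousAt_to (c : E.Chart x) {b : T → X} {e : ∀ t, E.fiber (b t)} {t₀ : T}
    (h : ContinuousAt (fun t => (⟨b t, e t⟩ : Total E.fiber)) t₀) (ht : b t₀ ∈ c.source) :
    ContinuousAt (fun t => c.toModel (b t) (e t)) t₀ :=
  ContinuousAt.comp (f := fun t => (⟨b t, e t⟩ : Total E.fiber))
    (g := fun z : Total E.fiber => c.toModel z.base z.vec)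
    (c.continuousOn_to.continuousAt
      ((c.isOpen_source.preimage E.continuous_proj).mem_nhds ht)) h

theorem continuousAt_of (c : E.Chart x) {b : T → X} {v : T → (Fin c.rank → 𝕜)} {t₀ : T}
    (hb : ContinuousAt b t₀) (hv : ContinuousAt v t₀) (ht : b t₀ ∈ c.source) :
    ContinuousAt (fun t => (⟨b t, c.ofModel (b t) (v t)⟩ : Total E.fiber)) t₀ :=
  ContinuousAt.comp (f := fun t => (b t, v t))
    (g := fun w : X × (Fin c.rank → 𝕜) => (⟨w.1, c.ofModel w.1 w.2⟩ : Total E.fiber))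
    (c.continuousOn_of.continuousAt
      ((c.isOpen_source.preimage continuous_fst).mem_nhds ht)) (hb.prodMk hv)

/-- Continuity of a map into a total space can be tested in a chart. -/
theorem continuousAt_of_toModel (c : E.Chart x) {b : T → X} {e : ∀ t, E.fiber (b t)} {t₀ : T}
    (hb : ContinuousAt b t₀) (ht : b t₀ ∈ c.source)
    (h : ContinuousAt (fun t => c.toModel (b t) (e t)) t₀) :
    ContinuousAt (fun t => (⟨b t, e t⟩ : Total E.fiber)) t₀ := by
  refine (c.continuousAt_of hb h ht).congr ?_
  filter_upwards [hb.preimage_mem_nhds (c.isOpen_source.mem_nhds ht)] with t h'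
  rw [c.of_to _ h']

end Family.Chart

namespace Family.IsLocallyTrivial

variable {E : Family 𝕜 X} {T : Type*} [TopologicalSpace T] {b : T → X}

/-- A `Family` does not itself require its fiberwise operations to be continuous. Local triviality
provides this, because a chart turns addition into that of `𝕜ⁿ`. -/
theorem continuous_add (hE : E.IsLocallyTrivial) {e e' : ∀ t, E.fiber (b t)}
    (h : Continuous fun t => (⟨b t, e t⟩ : Total E.fiber))
    (h' : Continuous fun t => (⟨b t, e' t⟩ : Total E.fiber)) :
    Continuous fun t => (⟨b t, e t + e' t⟩ : Total E.fiber) := by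
  have hb : Continuous b := E.continuous_proj.comp h
  refine continuous_iff_continuousAt.2 fun t₀ => ?_
  obtain ⟨c⟩ := hE.exists_chart (b t₀)
  refine c.continuousAt_of_toModel hb.continuousAt c.mem_source ?_
  simp only [map_add]
  exact (c.continuousAt_to h.continuousAt c.mem_source).add
    (c.continuousAt_to h'.continuousAt c.mem_source)

theorem continuous_zero (hE : E.IsLocallyTrivial) (hb : Continuous b) :
    Continuous fun t => (⟨b t, 0⟩ : Total E.fiber) := by
  refine continuous_iff_continuousAt.2 fun t₀ => ?_
  obtain ⟨c⟩ := hE.exists_chart (b t₀)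
  refine c.continuousAt_of_toModel hb.continuousAt c.mem_source ?_
  simp only [map_zero]
  exact continuousAt_const

end Family.IsLocallyTrivial

end Charts

/-! ### Presentations of bundles as retracts of trivial bundles -/

section Presentations

variable {𝕜 : Type} [RCLike 𝕜] {X : Type u} [TopologicalSpace X] {Y : Type v} [TopologicalSpace Y]

/-- A presentation of a family as a retract of the constant family with fiber `V`. -/
structure Family.Presentation (E : Family 𝕜 X) (V : Type) [NormedAddCommGroup V]
    [NormedSpace 𝕜 V] where
  s : ∀ x, E.fiber x →ₗ[𝕜] V
  t : ∀ x, V →ₗ[𝕜] E.fiber x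
  t_s : ∀ x e, t x (s x e) = e
  continuous_s : Continuous fun z : Total E.fiber => s z.base z.vec
  continuous_t : Continuous fun w : X × V => (⟨w.1, t w.1 w.2⟩ : Total E.fiber)

/-- Near a point, a scalar multiple of the identity of a locally trivial family factors through a
finite-dimensional constant family. -/
theorem Family.IsLocallyTrivial.exists_local_retract [CompactSpace X] [T2Space X] {E : Family 𝕜 X}
    (hE : E.IsLocallyTrivial) (x : X) :
    ∃ (n : ℕ) (s : ∀ y, E.fiber y →ₗ[𝕜] (Fin n → 𝕜)) (t : ∀ y, (Fin n → 𝕜) →ₗ[𝕜] E.fiber y)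
      (ρ : C(X, ℝ)), (Continuous fun z : Total E.fiber => s z.base z.vec) ∧
      (Continuous fun w : X × (Fin n → 𝕜) => (⟨w.1, t w.1 w.2⟩ : Total E.fiber)) ∧
      (∀ y, 0 ≤ ρ y) ∧ (∀ᶠ y in 𝓝 x, 0 < ρ y) ∧ ∀ y e, t y (s y e) = (ρ y : 𝕜) • e := by
  obtain ⟨c⟩ := hE.exists_chart x
  -- A Urysohn function with value `1` at `x` and support inside the chart.
  obtain ⟨f, hf, hf1, -⟩ := exists_tsupport_one_of_isOpen_isClosed c.isOpen_source
    isClosed_closure.isCompact (isClosed_singleton (x := x))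
    (Set.singleton_subset_iff.2 c.mem_source)
  have hfc : Continuous fun y => (f y : 𝕜) := RCLike.continuous_ofReal.comp f.continuous
  have hz : ∀ y, y ∉ c.source → ∀ᶠ y' in 𝓝 y, f y' = 0 := fun y hy => by
    have := (isClosed_tsupport f).isOpen_compl.mem_nhds (fun h => hy (hf h) : y ∈ (tsupport f)ᶜ)
    filter_upwards [this] with y' hy'
    exact image_eq_zero_of_notMem_tsupport hy'
  -- Each of the two chart maps needs its own factor `f` to be continuous across the edge of the
  -- chart, so the composition is multiplication by `f * f`.
  refine ⟨c.rank, fun y => (f y : 𝕜) • c.toModel y, fun y => (f y : 𝕜) • c.ofModel y, f * f,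
    ?_, ?_, fun y => mul_self_nonneg _, ?_, fun y e => ?_⟩
  · refine continuous_iff_continuousAt.2 fun z => ?_
    by_cases hz' : z.base ∈ c.source
    · exact (hfc.comp E.continuous_proj).continuousAt.smul
        (c.continuousAt_to continuousAt_id hz')
    · refine (continuousAt_const (y := 0)).congr ?_
      filter_upwards [E.continuous_proj.continuousAt.eventually (hz _ hz')] with z' h
      simp [h]
  · refine continuous_iff_continuousAt.2 fun w => ?_
    by_cases hz' : w.1 ∈ c.source
    · simp only [LinearMap.smul_apply, ← map_smul]
      exact c.continuousAt_of continuousAt_fst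
        ((hfc.comp continuous_fst).continuousAt.smul continuousAt_snd) hz'
    · refine (hE.continuous_zero continuous_fst).continuousAt.congr ?_
      filter_upwards [continuousAt_fst.eventually (hz _ hz')] with w' h
      simp [h]
  · have : 0 < (f * f) x := by simp [hf1 (Set.mem_singleton x)]
    exact (f * f).continuous.continuousAt.eventually (lt_mem_nhds this)
  · by_cases hy : y ∈ c.source
    · simp only [LinearMap.smul_apply, map_smul, c.of_to y hy, smul_smul, ContinuousMap.mul_apply,
        RCLike.ofReal_mul]
    · simp [(hz y hy).self_of_nhds]

/-- Local retracts add up: on `V × V'` the two scalars `ρ` and `ρ'` are summed. By compactness,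
finitely many of them give a scalar that is positive everywhere, and dividing by it makes the
composition the identity. No partition of unity has to be chosen. -/
theorem VectorBundle.exists_presentation [CompactSpace X] [T2Space X] (E : VectorBundle 𝕜 X) :
    ∃ (V : Type) (_ : NormedAddCommGroup V) (_ : NormedSpace 𝕜 V) (_ : FiniteDimensional 𝕜 V),
      Nonempty (E.toFamily.Presentation V) := by
  have hE := E.isLocallyTrivial
  suffices h : ∃ (V : Type) (_ : NormedAddCommGroup V) (_ : NormedSpace 𝕜 V)
      (_ : FiniteDimensional 𝕜 V) (s : ∀ y, E.fiber y →ₗ[𝕜] V)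
      (t : ∀ y, V →ₗ[𝕜] E.fiber y) (ρ : C(X, ℝ)),
      (Continuous fun z : Total E.fiber => s z.base z.vec) ∧
      (Continuous fun w : X × V => (⟨w.1, t w.1 w.2⟩ : Total E.fiber)) ∧
      (∀ y, 0 ≤ ρ y) ∧ (∀ y ∈ Set.univ, 0 < ρ y) ∧ ∀ y e, t y (s y e) = (ρ y : 𝕜) • e by
    obtain ⟨V, _, _, _, s, t, ρ, hs, ht, -, hρ, hst⟩ := h
    have hρ' : ∀ y, (ρ y : 𝕜) ≠ 0 := fun y => by
      exact_mod_cast (hρ y (Set.mem_univ y)).ne'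
    have hρc : Continuous fun y => (ρ y : 𝕜)⁻¹ :=
      (RCLike.continuous_ofReal.comp ρ.continuous).inv₀ hρ'
    refine ⟨V, _, _, inferInstance, ⟨⟨fun y => (ρ y : 𝕜)⁻¹ • s y, t, fun x e => ?_, ?_, ht⟩⟩⟩
    · simp [hst, smul_smul, hρ']
    · exact (hρc.comp E.continuous_proj).smul hs
  -- Only positivity depends on the set `S`. Nonnegativity is kept on all of `X`, so that adding a
  -- second scalar cannot destroy positivity already obtained.
  refine isCompact_univ.induction_on (p := fun S => ∃ (V : Type) (_ : NormedAddCommGroup V)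
      (_ : NormedSpace 𝕜 V) (_ : FiniteDimensional 𝕜 V) (s : ∀ y, E.fiber y →ₗ[𝕜] V)
      (t : ∀ y, V →ₗ[𝕜] E.fiber y) (ρ : C(X, ℝ)),
      (Continuous fun z : Total E.fiber => s z.base z.vec) ∧
      (Continuous fun w : X × V => (⟨w.1, t w.1 w.2⟩ : Total E.fiber)) ∧
      (∀ y, 0 ≤ ρ y) ∧ (∀ y ∈ S, 0 < ρ y) ∧ ∀ y e, t y (s y e) = (ρ y : 𝕜) • e) ?_ ?_ ?_ ?_
  · refine ⟨Fin 0 → 𝕜, inferInstance, inferInstance, inferInstance, fun _ => 0, fun _ => 0, 0,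
      continuous_const, hE.continuous_zero continuous_fst, fun _ => le_rfl, by simp, by simp⟩
  · rintro S T hST ⟨V, _, _, _, s, t, ρ, hs, ht, h0, hρ, hst⟩
    exact ⟨V, _, _, inferInstance, s, t, ρ, hs, ht, h0, fun y hy => hρ y (hST hy), hst⟩
  · rintro S T ⟨V, _, _, _, s, t, ρ, hs, ht, h0, hρ, hst⟩
      ⟨V', _, _, _, s', t', ρ', hs', ht', h0', hρ', hst'⟩
    refine ⟨V × V', inferInstance, inferInstance, inferInstance, fun y => (s y).prod (s' y),
      fun y => (t y).coprod (t' y), ρ + ρ', hs.prodMk hs', ?_,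
      fun y => add_nonneg (h0 y) (h0' y), ?_, fun y e => ?_⟩
    · exact hE.continuous_add (ht.comp (continuous_fst.prodMk (continuous_fst.comp continuous_snd)))
        (ht'.comp (continuous_fst.prodMk (continuous_snd.comp continuous_snd)))
    · rintro y (hy | hy)
      · exact add_pos_of_pos_of_nonneg (hρ y hy) (h0' y)
      · exact add_pos_of_nonneg_of_pos (h0 y) (hρ' y hy)
    · simp [hst, hst', add_smul]
  · intro x _
    obtain ⟨n, s, t, ρ, hs, ht, h0, hρ, hst⟩ := hE.exists_local_retract x
    exact ⟨_, mem_nhdsWithin_of_mem_nhds hρ, _, inferInstance, inferInstance, inferInstance, s, t,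
      ρ, hs, ht, h0, fun y hy => hy, hst⟩

namespace Family.Presentation

variable {E F : Family 𝕜 X} {V W : Type} [NormedAddCommGroup V] [NormedSpace 𝕜 V]
  [FiniteDimensional 𝕜 V] [NormedAddCommGroup W] [NormedSpace 𝕜 W]

/-- Because `V` is finite-dimensional, continuity for the operator norm can be tested one vector at
a time. -/
theorem continuous_toContinuousLinearMap {f : X → V →ₗ[𝕜] W}
    (h : ∀ v, Continuous fun x => f x v) :
    Continuous fun x => LinearMap.toContinuousLinearMap (f x) :=
  continuous_clm_apply.2 h

/-- The continuous family of linear maps that represents an isomorphism between presented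
families. -/
def matrix (P : E.Presentation V) (Q : F.Presentation W) (a : Iso E F) : C(X, V →L[𝕜] W) where
  toFun x := LinearMap.toContinuousLinearMap (Q.s x ∘ₗ (a.equiv x).toLinearMap ∘ₗ P.t x)
  continuous_toFun := continuous_toContinuousLinearMap fun _ =>
    Q.continuous_s.comp (a.continuous_toFun.comp
      (P.continuous_t.comp (continuous_id.prodMk continuous_const)))

@[simp]
theorem matrix_apply (P : E.Presentation V) (Q : F.Presentation W) (a : Iso E F) (x : X) (v : V) :
    P.matrix Q a x v = Q.s x (a.equiv x (P.t x v)) := rfl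

/-- The idempotent that belongs to a presentation. -/
def proj (P : E.Presentation V) : C(X, V →L[𝕜] V) := P.matrix P (Iso.refl E)

@[simp]
theorem proj_apply (P : E.Presentation V) (x : X) (v : V) : P.proj x v = P.s x (P.t x v) := rfl

theorem proj_comp_proj (P : E.Presentation V) (x : X) :
    (P.proj x).comp (P.proj x) = P.proj x := by
  ext v
  simp [P.t_s]

end Family.Presentation

/-- Two families of linear maps that are inverse to each other between the images of the
idempotents `p` and `q`. -/
structure IdemEquiv {V W : Type} [NormedAddCommGroup V] [NormedSpace 𝕜 V]
    [NormedAddCommGroup W] [NormedSpace 𝕜 W] (p : C(X, V →L[𝕜] V)) (q : C(X, W →L[𝕜] W)) where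
  u : C(X, V →L[𝕜] W)
  v : C(X, W →L[𝕜] V)
  v_u : ∀ x e, v x (u x e) = p x e
  u_v : ∀ x e, u x (v x e) = q x e
  u_p : ∀ x e, u x (p x e) = u x e
  v_q : ∀ x e, v x (q x e) = v x e

namespace IdemEquiv

variable {V W : Type} [NormedAddCommGroup V] [NormedSpace 𝕜 V] [NormedAddCommGroup W]
  [NormedSpace 𝕜 W] {p : C(X, V →L[𝕜] V)} {q : C(X, W →L[𝕜] W)}

/-- The normalizations on the source side suffice: `q u = u v u = u p = u`, and symmetrically for
`v`. -/
theorem q_u (r : IdemEquiv p q) (x : X) (e : V) : q x (r.u x e) = r.u x e := by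
  rw [← r.u_v, r.v_u, r.u_p]

theorem p_v (r : IdemEquiv p q) (x : X) (e : W) : p x (r.v x e) = r.v x e := by
  rw [← r.v_u, r.u_v, r.v_q]

def symm (r : IdemEquiv p q) : IdemEquiv q p := ⟨r.v, r.u, r.u_v, r.v_u, r.v_q, r.u_p⟩

def trans {U : Type} [NormedAddCommGroup U] [NormedSpace 𝕜 U] {o : C(X, U →L[𝕜] U)}
    (r : IdemEquiv p q) (r' : IdemEquiv q o) : IdemEquiv p o where
  u := ⟨fun x => (r'.u x).comp (r.u x), r'.u.continuous.clm_comp r.u.continuous⟩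
  v := ⟨fun x => (r.v x).comp (r'.v x), r.v.continuous.clm_comp r'.v.continuous⟩
  v_u x e := by simp [r'.v_u, r.q_u, r.v_u]
  u_v x e := by simp [r.u_v, r'.p_v, r'.u_v]
  u_p x e := by simp [r.u_p]
  v_q x e := by simp [r'.v_q]

end IdemEquiv

namespace Family.Presentation

variable {E F : Family 𝕜 X} {V W : Type} [NormedAddCommGroup V] [NormedSpace 𝕜 V]
  [FiniteDimensional 𝕜 V] [NormedAddCommGroup W] [NormedSpace 𝕜 W] [FiniteDimensional 𝕜 W]

/-- Isomorphisms of presented families give equivalences of idempotents. -/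
def idemEquiv (P : E.Presentation V) (Q : F.Presentation W) (a : Iso E F) :
    IdemEquiv P.proj Q.proj where
  u := P.matrix Q a
  v := Q.matrix P a.symm
  v_u x e := by simp [Q.t_s, Iso.symm]
  u_v x e := by simp [P.t_s, Iso.symm]
  u_p x e := by simp [P.t_s]
  v_q x e := by simp [Q.t_s]

theorem t_proj (P : E.Presentation V) (x : X) (v : V) : P.t x (P.proj x v) = P.t x v := by
  simp [P.t_s]

theorem proj_s (P : E.Presentation V) (x : X) (e : E.fiber x) : P.proj x (P.s x e) = P.s x e := by
  simp [P.t_s]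

/-- Equivalences of idempotents give isomorphisms of presented families. -/
def iso (P : E.Presentation V) (Q : F.Presentation W) (r : IdemEquiv P.proj Q.proj) :
    Iso E F where
  equiv x := LinearEquiv.ofLinearMap (Q.t x ∘ₗ (r.u x).toLinearMap ∘ₗ P.s x)
    (P.t x ∘ₗ (r.v x).toLinearMap ∘ₗ Q.s x)
    (by
      ext e
      have : P.s x (P.t x (r.v x (Q.s x e))) = r.v x (Q.s x e) := r.p_v x _
      simp [this, r.u_v, Q.t_s])
    (by
      ext e
      have : Q.s x (Q.t x (r.u x (P.s x e))) = r.u x (P.s x e) := r.q_u x _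
      simp [this, r.v_u, P.t_s])
  continuous_toFun := Q.continuous_t.comp <| E.continuous_proj.prodMk <|
    (r.u.continuous.comp E.continuous_proj).clm_apply P.continuous_s
  continuous_invFun := P.continuous_t.comp <| F.continuous_proj.prodMk <|
    (r.v.continuous.comp F.continuous_proj).clm_apply Q.continuous_s

/-- The pullback of a presentation. -/
def pullback (P : E.Presentation V) (f : C(Y, X)) : (E.pullback f).Presentation V where
  s y := P.s (f y)
  t y := P.t (f y)
  t_s y := P.t_s (f y)
  continuous_s := P.continuous_s.comp (continuous_pullback_lift f E)
  continuous_t := continuous_pullback.2 ⟨continuous_fst,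
    P.continuous_t.comp ((f.continuous.comp continuous_fst).prodMk continuous_snd)⟩

end Family.Presentation

/-- The presentation of a trivial family by itself. -/
def Family.trivialPresentation (𝕜 : Type) [RCLike 𝕜] (X : Type u) [TopologicalSpace X] (n : ℕ) :
    (Family.trivial 𝕜 X n).Presentation (Fin n → 𝕜) where
  s _ := LinearMap.id
  t _ := LinearMap.id
  t_s _ _ := rfl
  continuous_s := Family.continuous_trivial_snd n
  continuous_t := Family.continuous_trivial.2 ⟨continuous_fst, continuous_snd⟩

/-! ### Bundles from idempotents -/

section Image

variable {V : Type} [NormedAddCommGroup V] [NormedSpace 𝕜 V]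

/-- The family of images of the linear maps `p x`. -/
def Family.image (p : C(X, V →L[𝕜] V)) : Family 𝕜 X where
  fiber x := LinearMap.range (p x).toLinearMap
  top := TopologicalSpace.induced (fun z => ((z.base, (z.vec : V)) : X × V)) inferInstance
  continuous_proj := continuous_of_induced _ continuous_fst fun _ => rfl

theorem Family.continuous_image {T : Type*} [TopologicalSpace T] {p : C(X, V →L[𝕜] V)}
    {g : T → Total (Family.image p).fiber} :
    Continuous g ↔ Continuous (fun t => (g t).base) ∧ Continuous (fun t => ((g t).vec.1 : V)) :=
  continuous_induced_rng.trans continuous_prodMk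

/-- The tautological presentation of the family of images of an idempotent. -/
def Family.imagePresentation (p : C(X, V →L[𝕜] V)) (hp : ∀ x v, p x (p x v) = p x v) :
    (Family.image p).Presentation V where
  s x := (LinearMap.range (p x).toLinearMap).subtype
  t x := (p x).toLinearMap.rangeRestrict
  t_s x := by
    rintro ⟨_, v, rfl⟩
    exact Subtype.ext (hp x v)
  continuous_s := (Family.continuous_image.1 continuous_id).2
  continuous_t := Family.continuous_image.2 ⟨continuous_fst,
    (p.continuous.comp continuous_fst).clm_apply continuous_snd⟩

end Image

end Presentations

/-! ### Idempotents and homotopy invariance -/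

section Homotopy

variable {𝕜 : Type} [RCLike 𝕜] {X : Type u} [TopologicalSpace X] {Y : Type v} [TopologicalSpace Y]
  {V W : Type} [NormedAddCommGroup V] [NormedSpace 𝕜 V] [FiniteDimensional 𝕜 V]
  [NormedAddCommGroup W] [NormedSpace 𝕜 W] [FiniteDimensional 𝕜 W]

variable (𝕜 V) in
theorem isOpen_setOf_isUnit_clm : IsOpen {f : V →L[𝕜] V | IsUnit f} := by
  have : CompleteSpace V := FiniteDimensional.complete 𝕜 V
  exact Units.isOpen

theorem exists_inverse_of_isUnit (g : C(X, V →L[𝕜] V)) (hg : ∀ x, IsUnit (g x)) :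
    ∃ g' : C(X, V →L[𝕜] V), (∀ x v, g' x (g x v) = v) ∧ ∀ x v, g x (g' x v) = v := by
  have : CompleteSpace V := FiniteDimensional.complete 𝕜 V
  refine ⟨⟨fun x => Ring.inverse (g x), continuous_iff_continuousAt.2 fun x => ?_⟩,
    fun x v => ?_, fun x v => ?_⟩
  · obtain ⟨a, ha⟩ := hg x
    exact ContinuousAt.comp (ha ▸ NormedRing.inverse_continuousAt a) g.continuous.continuousAt
  · exact congrArg (fun f : V →L[𝕜] V => f v) (Ring.inverse_mul_cancel _ (hg x))
  · exact congrArg (fun f : V →L[𝕜] V => f v) (Ring.mul_inverse_cancel _ (hg x))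

/-- This is the tube lemma: invertibility is an open condition, and compactness of `X` makes the
neighbourhood of `t₀` uniform in `x`. -/
theorem eventually_forall_isUnit [CompactSpace X] {T : Type*} [TopologicalSpace T]
    (g : C(X × T, V →L[𝕜] V)) (t₀ : T) (h : ∀ x, g (x, t₀) = 1) :
    ∀ᶠ t in 𝓝 t₀, ∀ x, IsUnit (g (x, t)) := by
  have := isCompact_univ.eventually_forall_of_forall_eventually (x₀ := t₀) (K := Set.univ)
    (P := fun t x => IsUnit (g (x, t))) fun x _ => ?_
  · simpa using this
  · have hc : Continuous fun z : T × X => g (z.2, z.1) := by fun_prop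
    refine hc.continuousAt.eventually ((isOpen_setOf_isUnit_clm 𝕜 V).mem_nhds ?_)
    simp [h]

/-- The inclusion of `X` in `X × T` at `t`. -/
def slice (X : Type u) [TopologicalSpace X] {T : Type*} [TopologicalSpace T] (t : T) :
    C(X, X × T) := ⟨fun x => (x, t), by fun_prop⟩

@[simp]
theorem slice_apply {T : Type*} [TopologicalSpace T] (t : T) (x : X) : slice X t x = (x, t) := rfl

/-- An invertible family of linear maps that intertwines `p` and `q` gives an equivalence. -/
theorem nonempty_idemEquiv_of_isUnit {p q : C(X, V →L[𝕜] V)} (hp : ∀ x v, p x (p x v) = p x v)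
    (g : C(X, V →L[𝕜] V)) (hg : ∀ x, IsUnit (g x)) (h : ∀ x v, g x (p x v) = q x (g x v)) :
    Nonempty (IdemEquiv p q) := by
  obtain ⟨g', hl, hr⟩ := exists_inverse_of_isUnit g hg
  -- The pair is `u = g p` and `v = p g⁻¹`; intertwining means `q = g p g⁻¹`.
  refine ⟨⟨⟨fun x => (g x).comp (p x), g.continuous.clm_comp p.continuous⟩,
    ⟨fun x => (p x).comp (g' x), p.continuous.clm_comp g'.continuous⟩, fun x e => ?_, fun x e => ?_,
    fun x e => ?_, fun x e => ?_⟩⟩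
  · simp [hl, hp]
  · simp [hp, h, hr]
  · simp [hp]
  · have := h x (g' x e)
    simp only [hr] at this
    simp [← this, hl, hp]

/-- Nearby members of a continuous family of idempotents are equivalent, hence all are. -/
theorem nonempty_idemEquiv_slice [CompactSpace X] {T : Type*} [TopologicalSpace T]
    [PreconnectedSpace T] (p : C(X × T, V →L[𝕜] V)) (hp : ∀ x v, p x (p x v) = p x v) (t₀ t₁ : T) :
    Nonempty (IdemEquiv (p.comp (slice X t₀)) (p.comp (slice X t₁))) := by
  let P : T → T → Prop := fun s t => Nonempty (IdemEquiv (p.comp (slice X s)) (p.comp (slice X t)))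
  have : Std.Symm P := ⟨fun _ _ ⟨r⟩ => ⟨r.symm⟩⟩
  -- On a connected parameter space an equivalence relation that holds between every point and its
  -- neighbours holds throughout, so `t` may be taken close to `s`.
  refine PreconnectedSpace.induction₂ P (fun s => ?_) ⟨fun _ _ _ ⟨r⟩ ⟨r'⟩ => ⟨r.trans r'⟩⟩ t₀ t₁
  -- The operator `p_t p_s + (1 - p_t)(1 - p_s)` intertwines `p_s` with `p_t` and is the identity at
  -- `t = s`, hence invertible nearby.
  let g : C(X × T, V →L[𝕜] V) :=
    ⟨fun z => (p z).comp (p (z.1, s)) + (1 - p z).comp (1 - p (z.1, s)), by fun_prop⟩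
  have hg : ∀ z v, g z v = p z (p (z.1, s) v) + (v - p (z.1, s) v - p z (v - p (z.1, s) v)) :=
    fun z v => by simp [g]; abel
  have h1 : ∀ x, g (x, s) = 1 := fun x => by
    ext v
    rw [hg]
    simp [hp]
  filter_upwards [eventually_forall_isUnit g s h1] with t ht
  refine nonempty_idemEquiv_of_isUnit (fun x v => hp _ v) (g.comp (slice X t)) ht fun x v => ?_
  simp [hg, hp]

/-- The idempotent of `E`, pulled back along the homotopy, is a path of idempotents over `X` whose
ends present the two pullbacks. -/
theorem VectorBundle.isIso_pullback_of_homotopic [CompactSpace X] [CompactSpace Y] [T2Space Y]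
    (E : VectorBundle 𝕜 Y) {f g : C(X, Y)} (h : f.Homotopic g) :
    (E.pullback f).IsIso (E.pullback g) := by
  obtain ⟨H⟩ := h
  obtain ⟨V, _, _, _, ⟨P⟩⟩ := E.exists_presentation
  let H' : C(X × unitInterval, Y) := ⟨fun z => H (z.2, z.1), by fun_prop⟩
  have h0 : H'.comp (slice X 0) = f := by ext x; simp [H']
  have h1 : H'.comp (slice X 1) = g := by ext x; simp [H']
  obtain ⟨r⟩ := nonempty_idemEquiv_slice (P.proj.comp H')
    (fun x v => congrArg (fun l : V →L[𝕜] V => l v) (P.proj_comp_proj _)) 0 1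
  rw [ContinuousMap.comp_assoc, ContinuousMap.comp_assoc, h0, h1] at r
  exact ⟨(P.pullback f).iso (P.pullback g) r⟩

/-- A family that is presented by the identity is trivial. -/
theorem Family.Presentation.nonempty_iso_trivial {E : Family 𝕜 X} (P : E.Presentation V)
    (h : ∀ x v, P.proj x v = v) :
    Nonempty (Iso E (Family.trivial 𝕜 X (Module.finrank 𝕜 V))) := by
  let β : V ≃L[𝕜] (Fin (Module.finrank 𝕜 V) → 𝕜) := ContinuousLinearEquiv.ofFinrankEq (by simp)
  exact ⟨P.iso (Family.trivialPresentation 𝕜 X _)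
    ⟨.const X β, .const X β.symm, by simp [h], fun _ e => β.apply_symm_apply e, by simp [h],
      fun _ _ => rfl⟩⟩

/-- Near `x` the operator `p_x p_y + (1 - p_x)(1 - p_y)` is invertible and intertwines `p_y` with
the constant idempotent `p_x`. A basis of the single space `range (p x)` then trivializes the
family. -/
theorem Family.isLocallyTrivial_image (p : C(X, V →L[𝕜] V)) (hp : ∀ x v, p x (p x v) = p x v) :
    (Family.image p).IsLocallyTrivial := by
  intro x
  let g : C(X, V →L[𝕜] V) := ⟨fun y => (p x).comp (p y) + (1 - p x).comp (1 - p y), by fun_prop⟩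
  have hg : ∀ y v, g y v = p x (p y v) + (v - p y v - p x (v - p y v)) := fun y v => by simp [g]; abel
  have hgx : g x = 1 := by
    ext v
    rw [hg]
    simp [hp]
  let U : Set X := {y | IsUnit (g y)}
  have hU : IsOpen U := (isOpen_setOf_isUnit_clm 𝕜 V).preimage g.continuous
  refine ⟨U, hU, by simp [U, hgx], Module.finrank 𝕜 (LinearMap.range (p x).toLinearMap), ?_⟩
  let i : C(U, X) := ⟨Subtype.val, continuous_subtype_val⟩
  obtain ⟨r⟩ := nonempty_idemEquiv_of_isUnit (p := p.comp i) (q := .const U (p x))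
    (fun y v => hp y v) (g.comp i) (fun y => y.2) (fun y v => by simp [hg, hp, i])
  let P := (Family.imagePresentation p hp).pullback i
  let Q : (Family.image (.const U (p x))).Presentation V :=
    Family.imagePresentation (.const U (p x)) (fun _ => hp x)
  let β : LinearMap.range (p x).toLinearMap ≃ₗ[𝕜]
      (Fin (Module.finrank 𝕜 (LinearMap.range (p x).toLinearMap)) → 𝕜) :=
    LinearEquiv.ofFinrankEq _ _ (by simp)
  let a := LinearMap.toContinuousLinearMap (β.toLinearMap ∘ₗ (p x).toLinearMap.rangeRestrict)
  let b := LinearMap.toContinuousLinearMap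
    ((LinearMap.range (p x).toLinearMap).subtype ∘ₗ β.symm.toLinearMap)
  have hb : ∀ e, p x (b e) = b e := fun e => by
    obtain ⟨v, hv⟩ := (β.symm e).2
    simp only [b, LinearMap.coe_toContinuousLinearMap', LinearMap.comp_apply, Submodule.subtype_apply,
      LinearEquiv.coe_coe]
    rw [← hv]
    exact hp x v
  have hab : ∀ e, a (b e) = e := fun e => by
    simp only [a, LinearMap.coe_toContinuousLinearMap', LinearMap.comp_apply, LinearEquiv.coe_coe]
    rw [show (p x).toLinearMap.rangeRestrict (b e) = β.symm e from Subtype.ext (hb e)]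
    simp
  have hba : ∀ v, b (a v) = p x v := fun v => by simp [a, b]
  refine ⟨P.iso (Family.trivialPresentation 𝕜 U _) (r.trans
    ⟨.const U a, .const U b, fun _ => hba, fun _ => hab, fun _ v => ?_, fun _ _ => rfl⟩)⟩
  change a (p x v) = a v
  rw [← hba, hab]

/-- The bundle of images of an idempotent. -/
def VectorBundle.image (p : C(X, V →L[𝕜] V)) (hp : ∀ x v, p x (p x v) = p x v) :
    VectorBundle 𝕜 X := ⟨Family.image p, Family.isLocallyTrivial_image p hp⟩

/-- The pullback along a constant map is trivial. -/
theorem VectorBundle.exists_isIso_trivial_of_const (E : VectorBundle 𝕜 Y) (y : Y) :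
    ∃ n, (E.pullback (.const X y)).IsIso (VectorBundle.trivial 𝕜 X n) := by
  obtain ⟨U, -, hy, n, ⟨a⟩⟩ := E.isLocallyTrivial y
  refine ⟨n, ⟨?_⟩⟩
  exact (Family.Iso.pullbackComp ⟨Subtype.val, continuous_subtype_val⟩
    (.const X (⟨y, hy⟩ : U)) E.toFamily).symm.trans
    ((a.pullback _).trans (Family.Iso.pullbackTrivial 𝕜 _ n))

theorem VectorBundle.exists_isIso_trivial_of_nullhomotopic [CompactSpace X] [CompactSpace Y]
    [T2Space Y] (E : VectorBundle 𝕜 Y) {f : C(X, Y)} (hf : f.Nullhomotopic) :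
    ∃ n, (E.pullback f).IsIso (VectorBundle.trivial 𝕜 X n) := by
  obtain ⟨y, hy⟩ := hf
  obtain ⟨n, hn⟩ := E.exists_isIso_trivial_of_const (X := X) y
  exact ⟨n, (E.isIso_pullback_of_homotopic hy).trans hn⟩

/-- The complement is the image of `1 - p`, where `p` is the idempotent of a presentation of `E`.
The direct sum is presented by `p + (1 - p) = 1`, which makes it trivial. -/
theorem VectorBundle.exists_sum_isIso_trivial [CompactSpace X] [T2Space X]
    (E : VectorBundle 𝕜 X) : ∃ (F : VectorBundle 𝕜 X) (n : ℕ),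
      (E.sum F).IsIso (VectorBundle.trivial 𝕜 X n) := by
  obtain ⟨V, _, _, _, ⟨P⟩⟩ := E.exists_presentation
  have hP : ∀ x v, P.proj x (P.proj x v) = P.proj x v := fun x v =>
    congrArg (fun l : V →L[𝕜] V => l v) (P.proj_comp_proj x)
  have hq : ∀ x v, (1 - P.proj) x ((1 - P.proj) x v) = (1 - P.proj) x v := fun x v => by
    change v - P.proj x v - P.proj x (v - P.proj x v) = v - P.proj x v
    rw [map_sub, hP]
    simp
  let Q := Family.imagePresentation (1 - P.proj) hq
  let R : (E.sum (VectorBundle.image (1 - P.proj) hq)).Presentation V :=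
    { s := fun x => (P.s x).coprod (Q.s x)
      t := fun x => (P.t x).prod (Q.t x)
      t_s := by
        rintro x ⟨e, ⟨_, v, rfl⟩⟩
        have h1 : (1 - P.proj) x (P.s x e) = 0 := by
          change P.s x e - P.proj x (P.s x e) = 0
          simp [P.proj_s]
        have h2 : P.t x ((1 - P.proj) x v) = 0 := by
          change P.t x (v - P.proj x v) = 0
          rw [map_sub, P.t_proj, sub_self]
        refine Prod.ext ?_ (Subtype.ext ?_)
        · change P.t x (P.s x e + (1 - P.proj) x v) = e
          rw [map_add, P.t_s, h2, add_zero]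
        · change (1 - P.proj) x (P.s x e + (1 - P.proj) x v) = (1 - P.proj) x v
          rw [map_add, h1, hq, zero_add]
      continuous_s := (P.continuous_s.comp (Family.continuous_sum_fst _ _)).add
        (Q.continuous_s.comp (Family.continuous_sum_snd _ _))
      continuous_t := Family.continuous_sum.2 ⟨P.continuous_t, Q.continuous_t⟩ }
  refine ⟨_, _, R.nonempty_iso_trivial fun x v => ?_⟩
  change P.proj x v + (v - P.proj x v) = v
  simp

end Homotopy

/-! ### Collapsing a closed subspace: bundles over the quotient -/

/-- The map `f : Y → Z` collapses the image of `i : A → Y` onto the image of `j : P → Z` and is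
bijective elsewhere. -/
structure IsCollapse {A Y Z P : Type*} [TopologicalSpace A] [TopologicalSpace Y]
    [TopologicalSpace Z] [TopologicalSpace P] (i : C(A, Y)) (f : C(Y, Z)) (j : C(P, Z)) :
    Prop where
  injective_incl : Function.Injective i
  surjective : Function.Surjective f
  injective_center : Function.Injective j
  mem_range_iff : ∀ y, f y ∈ Set.range j ↔ y ∈ Set.range i
  eq_or : ∀ y y', f y = f y' → y = y' ∨ (y ∈ Set.range i ∧ y' ∈ Set.range i)

/-- An idempotent `p` is equivalent to an idempotent that equals `0 ⊕ 1` wherever the given maps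
`u` and `v` identify `p` with the identity. -/
theorem exists_idemEquiv_prod {𝕜 : Type} [RCLike 𝕜] {Y : Type*} [TopologicalSpace Y]
    {V W : Type} [NormedAddCommGroup V] [NormedSpace 𝕜 V] [NormedAddCommGroup W] [NormedSpace 𝕜 W]
    (p : C(Y, V →L[𝕜] V)) (hp : ∀ y e, p y (p y e) = p y e) (u : C(Y, V →L[𝕜] W))
    (v : C(Y, W →L[𝕜] V)) :
    ∃ q : C(Y, V × W →L[𝕜] V × W), (∀ y z, q y (q y z) = q y z) ∧ Nonempty (IdemEquiv p q) ∧
      ∀ y, (∀ w, u y (v y w) = w) → (∀ e, v y (u y e) = p y e) → (∀ w, p y (v y w) = v y w) →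
        ∀ z, q y z = (0, z.2) := by
  -- These are the elementary block matrices with an off-diagonal entry `b`; they are invertible for
  -- every `b`.
  let e₁ : C(Y, W →L[𝕜] V) → C(Y, V × W →L[𝕜] V × W) := fun b =>
    ⟨fun y => 1 + (ContinuousLinearMap.inl 𝕜 V W).comp ((b y).comp
      (ContinuousLinearMap.snd 𝕜 V W)), by fun_prop⟩
  let e₂ : C(Y, V →L[𝕜] W) → C(Y, V × W →L[𝕜] V × W) := fun b =>
    ⟨fun y => 1 + (ContinuousLinearMap.inr 𝕜 V W).comp ((b y).comp
      (ContinuousLinearMap.fst 𝕜 V W)), by fun_prop⟩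
  have he₁ : ∀ b y z, e₁ b y z = (z.1 + b y z.2, z.2) := fun b y z => by
    ext <;> simp [e₁]
  have he₂ : ∀ b y z, e₂ b y z = (z.1, z.2 + b y z.1) := fun b y z => by
    ext <;> simp [e₂]
  -- The Whitehead trick: this product is invertible for arbitrary `u` and `v`. Where they are
  -- inverse to each other between the image of `p` and `W`, its block rows are `(1 - p, v)` and
  -- `(-u, 0)`, so it carries the image of `p` onto the summand `W`.
  let g : C(Y, V × W →L[𝕜] V × W) :=
    ⟨fun y => (e₁ v y).comp ((e₂ (-u) y).comp (e₁ v y)), by fun_prop⟩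
  let g' : C(Y, V × W →L[𝕜] V × W) :=
    ⟨fun y => (e₁ (-v) y).comp ((e₂ u y).comp (e₁ (-v) y)), by fun_prop⟩
  have hg : ∀ y z, g y z = e₁ v y (e₂ (-u) y (e₁ v y z)) := fun _ _ => rfl
  have hg' : ∀ y z, g' y z = e₁ (-v) y (e₂ u y (e₁ (-v) y z)) := fun _ _ => rfl
  have hgg : ∀ y z, g' y (g y z) = z := fun y z => by
    ext <;> simp [hg, hg', he₁, he₂] <;> abel
  -- This is `p ⊕ 0` conjugated by `g`.
  let q : C(Y, V × W →L[𝕜] V × W) :=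
    ⟨fun y => (g y).comp ((ContinuousLinearMap.inl 𝕜 V W).comp ((p y).comp
      ((ContinuousLinearMap.fst 𝕜 V W).comp (g' y)))), by fun_prop⟩
  have hq : ∀ y z, q y z = g y (p y (g' y z).1, 0) := fun y z => rfl
  refine ⟨q, fun y z => by simp only [hq, hgg, hp],
    ⟨⟨⟨fun y => (g y).comp ((ContinuousLinearMap.inl 𝕜 V W).comp (p y)), by fun_prop⟩,
      ⟨fun y => (p y).comp ((ContinuousLinearMap.fst 𝕜 V W).comp (g' y)), by fun_prop⟩,
      fun y e => ?_, fun y e => ?_, fun y e => ?_, fun y e => ?_⟩⟩, fun y h₁ h₂ h₃ z => ?_⟩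
  · simp [hgg, hp]
  · simp [hq, hp]
  · simp [hp]
  · simp [hq, hgg, hp]
  · simp only [hq, hg, hg', he₁, he₂, ContinuousMap.neg_apply, neg_apply, map_add, map_neg, h₁, h₂,
      h₃, hp]
    simp

section Collapse

variable {𝕜 : Type} [RCLike 𝕜] {A Y Z P : Type*} [TopologicalSpace A] [TopologicalSpace Y]
  [TopologicalSpace Z] [TopologicalSpace P] {i : C(A, Y)} {f : C(Y, Z)} {j : C(P, Z)}

namespace IsCollapse

theorem apply_eq [Subsingleton P] (h : IsCollapse i f j) (a a' : A) : f (i a) = f (i a') := by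
  obtain ⟨p, hp⟩ := (h.mem_range_iff (i a)).2 ⟨a, rfl⟩
  obtain ⟨p', hp'⟩ := (h.mem_range_iff (i a')).2 ⟨a', rfl⟩
  rw [← hp, ← hp', Subsingleton.elim p p']

/-- A map that is constant on the collapsed subspace factors through the quotient. -/
theorem exists_factor [CompactSpace Y] [T2Space Z] (h : IsCollapse i f j) {T : Type*}
    [TopologicalSpace T] (g : C(Y, T)) (hg : ∀ a a', g (i a) = g (i a')) :
    ∃ g' : C(Z, T), ∀ y, g' (f y) = g y := by
  have hq := IsQuotientMap.of_surjective_continuous h.surjective f.continuous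
  have hf : Function.FactorsThrough g f := fun y y' hy => ?_
  · exact ⟨hq.lift g hf, fun y => DFunLike.congr_fun (hq.lift_comp g hf) y⟩
  obtain rfl | ⟨⟨a, rfl⟩, ⟨a', rfl⟩⟩ := h.eq_or y y' hy
  · rfl
  · exact hg a a'

/-- A bundle that is trivial on the collapsed subspace comes from the quotient. -/
theorem exists_isIso_pullback [CompactSpace A] [CompactSpace Y] [T2Space Y] [T2Space Z]
    (h : IsCollapse i f j) (E : VectorBundle 𝕜 Y) {m : ℕ}
    (hE : (E.pullback i).IsIso (VectorBundle.trivial 𝕜 A m)) :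
    ∃ F : VectorBundle 𝕜 Z, (F.pullback f).IsIso E := by
  obtain ⟨a⟩ := hE
  obtain ⟨V, _, _, _, ⟨P⟩⟩ := E.exists_presentation
  have hP : ∀ x v, P.proj x (P.proj x v) = P.proj x v := fun x v =>
    congrArg (fun l : V →L[𝕜] V => l v) (P.proj_comp_proj x)
  let r := (P.pullback i).idemEquiv (Family.trivialPresentation 𝕜 A m) a
  have hi : IsClosedEmbedding i := i.continuous.isClosedEmbedding h.injective_incl
  -- Tietze extends the trivialization and its inverse as operator-valued maps only; away from `A`
  -- they are no longer inverse to each other, which `exists_idemEquiv_prod` tolerates.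
  obtain ⟨u, hu⟩ := ContinuousMap.exists_extension hi r.u
  obtain ⟨v, hv⟩ := ContinuousMap.exists_extension hi r.v
  replace hu : ∀ a, u (i a) = r.u a := fun a => DFunLike.congr_fun hu a
  replace hv : ∀ a, v (i a) = r.v a := fun a => DFunLike.congr_fun hv a
  obtain ⟨q, hqq, ⟨r'⟩, hqa⟩ := exists_idemEquiv_prod P.proj hP u v
  replace hqa : ∀ a z, q (i a) z = (0, z.2) := fun a => hqa (i a)
    (fun w => by rw [hu, hv]; exact r.u_v a w) (fun w => by rw [hu, hv]; exact r.v_u a w)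
    (fun w => by rw [hv]; exact r.p_v a w)
  -- On `A` the new idempotent is `0 ⊕ 1`, hence constant, so it descends to `Z`.
  obtain ⟨q', hq'⟩ := h.exists_factor q fun a a' =>
    ContinuousLinearMap.ext fun z => by rw [hqa, hqa]
  have hqq' : ∀ x z, q' x (q' x z) = q' x z := fun x z => by
    obtain ⟨y, rfl⟩ := h.surjective x
    rw [hq', hqq]
  let Q := (Family.imagePresentation q' hqq').pullback f
  have hQ : Q.proj = q := by
    ext1 y
    exact hq' y
  exact ⟨VectorBundle.image q' hqq', ⟨(P.iso Q (hQ ▸ r')).symm⟩⟩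

/-- If the collapsed subspace is contractible, an equivalence of idempotents over `Y` can be made
constant on it. -/
theorem exists_idemEquiv_constant [CompactSpace A] [CompactSpace Y] [T2Space Y]
    (h : IsCollapse i f j) [Subsingleton P] (hA : (ContinuousMap.id A).Nullhomotopic)
    {V W : Type} [NormedAddCommGroup V] [NormedSpace 𝕜 V] [FiniteDimensional 𝕜 V]
    [NormedAddCommGroup W] [NormedSpace 𝕜 W] [FiniteDimensional 𝕜 W]
    {p : C(Z, V →L[𝕜] V)} {q : C(Z, W →L[𝕜] W)} (r : IdemEquiv (p.comp f) (q.comp f)) :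
    ∃ r' : IdemEquiv (p.comp f) (q.comp f), ∀ a a', r'.u (i a) = r'.u (i a') := by
  obtain ⟨a₀, ⟨H⟩⟩ := hA
  -- Both idempotents come from `Z` and are therefore constant on `A`. Moving along the contraction
  -- thus keeps `u` an isomorphism between the same two images, from `u` on `A` at time `0` to its
  -- value at `a₀` at time `1`.
  let U : C(A × unitInterval, V →L[𝕜] W) := ⟨fun z => r.u (i (H (z.2, z.1))), by fun_prop⟩
  let U' : C(A × unitInterval, W →L[𝕜] V) := ⟨fun z => r.v (i (H (z.2, z.1))), by fun_prop⟩
  -- The relation asks for an automorphism over all of `Y` that commutes with the target idempotent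
  -- and carries stage `s` to stage `t` over `A`. It is an equivalence relation, so nearby stages
  -- suffice.
  let R : unitInterval → unitInterval → Prop := fun s t => ∃ g g' : C(Y, W →L[𝕜] W),
    (∀ y w, g' y (g y w) = w) ∧ (∀ y w, g y (g' y w) = w) ∧
    (∀ y w, g y (q (f y) w) = q (f y) (g y w)) ∧ ∀ a e, g (i a) (U (a, s) e) = U (a, t) e
  have hfix : ∀ a b, f (i a) = f (i b) := h.apply_eq
  have hsymm : Std.Symm R := ⟨fun s t ⟨g, g', h₁, h₂, h₃, h₄⟩ => ⟨g', g, h₂, h₁, fun y w => by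
    rw [← h₁ y (q (f y) (g' y w)), h₃, h₂], fun a e => by rw [← h₄, h₁]⟩⟩
  have htrans : IsTrans _ R := ⟨fun s t l ⟨g, g', h₁, h₂, h₃, h₄⟩ ⟨k, k', h₁', h₂', h₃', h₄'⟩ =>
    ⟨⟨fun y => (k y).comp (g y), by fun_prop⟩, ⟨fun y => (g' y).comp (k' y), by fun_prop⟩,
      by simp [h₁, h₁'], by simp [h₂, h₂'], by simp [h₃, h₃'], by simp [h₄, h₄']⟩⟩
  have hqq : ∀ y w, q (f y) (q (f y) w) = q (f y) w := fun y w => by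
    have := r.u_v y (q (f y) w)
    rw [show r.v y (q (f y) w) = r.v y w from r.v_q y w, r.u_v] at this
    exact this.symm
  have hi : IsClosedEmbedding i := i.continuous.isClosedEmbedding h.injective_incl
  have hR : R 0 1 := by
    refine PreconnectedSpace.induction₂ R (fun s => ?_) htrans 0 1
    let K : C(A × unitInterval, W →L[𝕜] W) :=
      ⟨fun z => (U z).comp (U' (z.1, s)), by fun_prop⟩
    obtain ⟨L, hL⟩ := ContinuousMap.exists_extension
      (hi.prodMap (IsClosedEmbedding.id (X := unitInterval))) K
    replace hL : ∀ a t, L (i a, t) = K (a, t) := fun a t => DFunLike.congr_fun hL (a, t)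
    -- Here `L` extends the transition `U_t U'_s` from `A` to `Y`. The operator `1 + q (L_t - L_s)
    -- q` commutes with `q`, is the identity at `t = s`, and sends `U_s` to `U_s + U_t p - U_s p =
    -- U_t` over `A`.
    let g : C(Y × unitInterval, W →L[𝕜] W) :=
      ⟨fun z => 1 + (q (f z.1)).comp ((L z - L (z.1, s)).comp (q (f z.1))), by fun_prop⟩
    have hg : ∀ z w, g z w = w + q (f z.1) (L z (q (f z.1) w) - L (z.1, s) (q (f z.1) w)) :=
      fun z w => by simp [g]
    filter_upwards [eventually_forall_isUnit g s fun x => by ext; simp [hg]] with t ht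
    obtain ⟨g', h₁, h₂⟩ := exists_inverse_of_isUnit (g.comp (slice Y t)) ht
    refine ⟨g.comp (slice Y t), g', h₁, h₂, fun y w => ?_, fun a e => ?_⟩
    · simp [hg, hqq]
    · have e₁ : ∀ t e, q (f (i a)) (U (a, t) e) = U (a, t) e := fun t e => by
        rw [hfix a (H (t, a))]
        exact r.q_u (i (H (t, a))) e
      have e₂ : U' (a, s) (U (a, s) e) = p (f (i (H (s, a)))) e := r.v_u _ e
      have e₃ : ∀ t e, U (a, t) (p (f (i (H (s, a)))) e) = U (a, t) e := fun t e => by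
        rw [hfix (H (s, a)) (H (t, a))]
        exact r.u_p (i (H (t, a))) e
      simp [hg, hL, K, e₁, e₂, e₃]
  obtain ⟨g, g', h₁, h₂, h₃, h₄⟩ := hR
  refine ⟨⟨⟨fun y => (g y).comp (r.u y), by fun_prop⟩, ⟨fun y => (r.v y).comp (g' y), by fun_prop⟩,
    fun y e => ?_, fun y e => ?_, fun y e => ?_, fun y e => ?_⟩, fun a a' => ?_⟩
  · simp only [ContinuousMap.coe_mk, ContinuousLinearMap.comp_apply, h₁, r.v_u]
  · simp only [ContinuousMap.coe_mk, ContinuousLinearMap.comp_apply, r.u_v]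
    rw [ContinuousMap.comp_apply, h₃, h₂]
  · simp only [ContinuousMap.coe_mk, ContinuousLinearMap.comp_apply, r.u_p]
  · have : g' y (q (f y) e) = q (f y) (g' y e) := by
      rw [← h₁ y (q (f y) (g' y e)), h₃, h₂]
    simp only [ContinuousMap.coe_mk, ContinuousLinearMap.comp_apply]
    rw [ContinuousMap.comp_apply, this]
    exact r.v_q y _
  · ext e
    have h₀ : ∀ a, U (a, 0) e = r.u (i a) e := fun a => by simp [U]
    have h₁' : ∀ a, U (a, 1) e = r.u (i a₀) e := fun a => by simp [U]
    simp only [ContinuousMap.coe_mk, ContinuousLinearMap.comp_apply, ← h₀, h₄, h₁']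

/-- If the collapsed subspace is contractible, bundles over the quotient with isomorphic pullbacks
are isomorphic. -/
theorem isIso_of_isIso_pullback [CompactSpace A] [CompactSpace Y] [T2Space Y] [T2Space Z]
    (h : IsCollapse i f j) [Subsingleton P] (hA : (ContinuousMap.id A).Nullhomotopic)
    (E F : VectorBundle 𝕜 Z) (hEF : (E.pullback f).IsIso (F.pullback f)) : E.IsIso F := by
  have : CompactSpace Z := h.surjective.compactSpace f.continuous
  obtain ⟨a⟩ := hEF
  obtain ⟨V, _, _, _, ⟨P⟩⟩ := E.exists_presentation
  obtain ⟨W, _, _, _, ⟨Q⟩⟩ := F.exists_presentation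
  obtain ⟨r, hr⟩ := h.exists_idemEquiv_constant (p := P.proj) (q := Q.proj) hA
    ((P.pullback f).idemEquiv (Q.pullback f) a)
  obtain ⟨u, hu⟩ := h.exists_factor r.u hr
  -- Only `u` was made constant on `A`. Since the idempotents are constant there too, `u` determines
  -- its inverse `v`, which is therefore constant as well.
  obtain ⟨v, hv⟩ := h.exists_factor r.v fun a a' => by
    refine ContinuousLinearMap.ext fun e => ?_
    have hP : P.proj (f (i a)) = P.proj (f (i a')) := congrArg _ (h.apply_eq a a')
    have hQ : Q.proj (f (i a)) = Q.proj (f (i a')) := congrArg _ (h.apply_eq a a')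
    calc r.v (i a) e = r.v (i a) (Q.proj (f (i a)) e) := (r.v_q _ _).symm
      _ = r.v (i a) (r.u (i a') (r.v (i a') e)) := by
        rw [hQ]
        exact congrArg _ (r.u_v _ _).symm
      _ = P.proj (f (i a)) (r.v (i a') e) := by
        rw [hr a' a]
        exact r.v_u _ _
      _ = r.v (i a') e := by
        rw [hP]
        exact r.p_v _ _
  refine ⟨P.iso Q ⟨u, v, fun x e => ?_, fun x e => ?_, fun x e => ?_, fun x e => ?_⟩⟩ <;>
    obtain ⟨y, rfl⟩ := h.surjective x <;> simp only [hu, hv]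
  exacts [r.v_u y e, r.u_v y e, r.u_p y e, r.v_q y e]

end IsCollapse

end Collapse

/-! ### Reduced K-groups of compact Hausdorff spaces -/

section RedK

variable {𝕜 : Type} [RCLike 𝕜] {X : Type u} [TopologicalSpace X] {Y : Type v} [TopologicalSpace Y]
  {Z : Type w} [TopologicalSpace Z]

theorem VectorBundle.sum_trivial_stablyEquiv (E : VectorBundle 𝕜 X) (n : ℕ) :
    (E.sum (VectorBundle.trivial 𝕜 X n)).StablyEquiv E :=
  ⟨0, n, by simpa using VectorBundle.sum_trivial_sum_trivial E n 0⟩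

namespace RedK

theorem mk_eq_mk {E F : VectorBundle 𝕜 X} : mk E = mk F ↔ E.StablyEquiv F :=
  Quotient.eq (r := stableSetoid 𝕜 X)

theorem mk_eq_zero {E : VectorBundle 𝕜 X} : mk E = 0 ↔
    ∃ n m, (E.sum (VectorBundle.trivial 𝕜 X n)).IsIso (VectorBundle.trivial 𝕜 X m) := by
  constructor
  · intro h
    obtain ⟨n, m, h⟩ := mk_eq_mk.1 (h : mk E = mk (VectorBundle.trivial 𝕜 X 0))
    exact ⟨n, 0 + m, h.trans (VectorBundle.trivial_sum 0 m)⟩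
  · rintro ⟨n, m, h⟩
    exact mk_eq_mk.2 ((E.sum_trivial_stablyEquiv n).symm.trans
      (h.stablyEquiv.trans (VectorBundle.trivial_stablyEquiv m 0)))

theorem exists_add_eq_zero [CompactSpace X] [T2Space X] (a : RedK 𝕜 X) :
    ∃ b : RedK 𝕜 X, a + b = 0 := by
  obtain ⟨E⟩ := a
  obtain ⟨F, n, h⟩ := E.exists_sum_isIso_trivial
  exact ⟨mk F, mk_eq_mk.2 (h.stablyEquiv.trans (VectorBundle.trivial_stablyEquiv n 0))⟩

instance [CompactSpace X] [T2Space X] : Neg (RedK 𝕜 X) := ⟨fun a => (exists_add_eq_zero a).choose⟩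

instance [CompactSpace X] [T2Space X] : AddCommGroup (RedK 𝕜 X) :=
  { (inferInstance : AddCommMonoid (RedK 𝕜 X)) with
    zsmul := zsmulRec
    neg_add_cancel := fun a => (add_comm _ _).trans (exists_add_eq_zero a).choose_spec }

theorem map_comp (f : C(Y, X)) (g : C(Z, Y)) (a : RedK 𝕜 X) :
    RedK.map 𝕜 (f.comp g) a = RedK.map 𝕜 g (RedK.map 𝕜 f a) := by
  obtain ⟨E⟩ := a
  exact mk_eq_mk.2 (VectorBundle.IsIso.stablyEquiv ⟨(Family.Iso.pullbackComp f g E.toFamily).symm⟩)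

theorem map_id (a : RedK 𝕜 X) : RedK.map 𝕜 (ContinuousMap.id X) a = a := by
  obtain ⟨E⟩ := a
  refine mk_eq_mk.2 (VectorBundle.IsIso.stablyEquiv ⟨⟨fun x => LinearEquiv.refl 𝕜 _, ?_, ?_⟩⟩)
  · exact Family.continuous_pullback_lift (ContinuousMap.id X) E.toFamily
  · exact Family.continuous_pullback.2 ⟨E.continuous_proj, continuous_id⟩

theorem map_eq_of_homotopic [CompactSpace X] [T2Space X] [CompactSpace Y] {f g : C(Y, X)}
    (h : f.Homotopic g) : RedK.map 𝕜 f = RedK.map 𝕜 g := by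
  ext a
  obtain ⟨E⟩ := a
  exact mk_eq_mk.2 (E.isIso_pullback_of_homotopic h).stablyEquiv

theorem map_eq_zero_of_nullhomotopic [CompactSpace X] [T2Space X] [CompactSpace Y] {f : C(Y, X)}
    (h : f.Nullhomotopic) (a : RedK 𝕜 X) : RedK.map 𝕜 f a = 0 := by
  obtain ⟨E⟩ := a
  obtain ⟨n, hn⟩ := E.exists_isIso_trivial_of_nullhomotopic h
  exact mk_eq_mk.2 (hn.stablyEquiv.trans (VectorBundle.trivial_stablyEquiv n 0))

end RedK

end RedK

theorem Collapse.mk_eq_mk {X : Type u} [TopologicalSpace X] {A : Set X} {x y : X} :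
    Collapse.mk A x = Collapse.mk A y ↔ x = y ∨ (x ∈ A ∧ y ∈ A) :=
  Quotient.eq (r := collapseSetoid A)

theorem Susp.mk_eq_mk {X : Type u} [TopologicalSpace X] {p q : X × unitInterval} :
    Susp.mk X p = Susp.mk X q ↔ p = q ∨ (p.2 = 0 ∧ q.2 = 0) ∨ (p.2 = 1 ∧ q.2 = 1) :=
  Quotient.eq (r := suspSetoid X)

theorem Susp.surjective_mk {X : Type u} [TopologicalSpace X] :
    Function.Surjective (Susp.mk X) := Quotient.mk_surjective

theorem Collapse.surjective_mk {X : Type u} [TopologicalSpace X] (A : Set X) :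
    Function.Surjective (Collapse.mk A) := Quotient.mk_surjective

/-- The collapse of the image of an injective map to a point. -/
theorem isCollapse_mk {A : Type u} [TopologicalSpace A] {X : Type v} [TopologicalSpace X]
    (i : C(A, X)) (hi : Function.Injective i) {S : Set X} (hS : Set.range i = S) (a₀ : A) :
    IsCollapse i (Collapse.mk S) (.const Unit (Collapse.mk S (i a₀))) where
  injective_incl := hi
  surjective := Collapse.surjective_mk S
  injective_center _ _ _ := rfl
  mem_range_iff y := by
    subst hS
    simp only [ContinuousMap.const_apply, Set.mem_range, exists_const, eq_comm (b := Collapse.mk _ y),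
      Collapse.mk_eq_mk]
    constructor
    · rintro (rfl | h)
      · exact ⟨a₀, rfl⟩
      · exact h.1
    · exact fun h => .inr ⟨h, a₀, rfl⟩
  eq_or y y' h := by
    subst hS
    exact Collapse.mk_eq_mk.1 h

/-! ### Exactness and bijectivity for collapses -/

section Main

variable {𝕜 : Type} [RCLike 𝕜] {A Y Z P : Type*} [TopologicalSpace A] [TopologicalSpace Y]
  [TopologicalSpace Z] [TopologicalSpace P] {i : C(A, Y)} {f : C(Y, Z)} {j : C(P, Z)}

namespace IsCollapse

theorem exists_apply_eq (h : IsCollapse i f j) (p : P) : ∃ a, f (i a) = j p := by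
  obtain ⟨y, hy⟩ := h.surjective (j p)
  obtain ⟨a, rfl⟩ := (h.mem_range_iff y).1 ⟨p, hy.symm⟩
  exact ⟨a, hy⟩

/-- Collapsing further to a point. -/
theorem comp_mk (h : IsCollapse i f j) (p : P) :
    IsCollapse i ((Collapse.mk (Set.range j)).comp f)
      (.const Unit (Collapse.mk (Set.range j) (j p))) := by
  have hj := isCollapse_mk j h.injective_center rfl p
  refine ⟨h.injective_incl, hj.surjective.comp h.surjective, hj.injective_center,
    fun y => ?_, fun y y' hy => ?_⟩
  · exact (hj.mem_range_iff (f y)).trans (h.mem_range_iff y)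
  · obtain hy | ⟨hy, hy'⟩ := hj.eq_or _ _ hy
    · exact h.eq_or y y' hy
    · exact .inr ⟨(h.mem_range_iff y).1 hy, (h.mem_range_iff y').1 hy'⟩

/-- Every bundle is trivial on the contractible `A` and so descends. For injectivity, the unstable
statement applies to the bundles after trivial summands have been added. -/
theorem bijective_map_of_subsingleton [CompactSpace A] [CompactSpace Y] [T2Space Y] [T2Space Z]
    [Subsingleton P] (h : IsCollapse i f j) (hA : (ContinuousMap.id A).Nullhomotopic) :
    Function.Bijective (RedK.map 𝕜 f) := by
  constructor
  · rintro ⟨E⟩ ⟨F⟩ hEF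
    obtain ⟨n, m, e⟩ := RedK.mk_eq_mk.1 hEF
    refine RedK.mk_eq_mk.2 ⟨n, m, h.isIso_of_isIso_pullback hA _ _ ?_⟩
    exact (VectorBundle.pullback_sum f _ _).trans <|
      ((VectorBundle.IsIso.refl _).sum (VectorBundle.pullback_trivial f n)).trans <|
      e.trans <| ((VectorBundle.IsIso.refl _).sum (VectorBundle.pullback_trivial f m).symm).trans
        (VectorBundle.pullback_sum f _ _).symm
  · rintro ⟨E⟩
    obtain ⟨m, hm⟩ := E.exists_isIso_trivial_of_nullhomotopic (f := i) (by
      have := hA.comp_right i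
      rwa [ContinuousMap.comp_id] at this)
    obtain ⟨F, hF⟩ := h.exists_isIso_pullback E hm
    exact ⟨RedK.mk F, RedK.mk_eq_mk.2 hF.stablyEquiv⟩

/-- If the class of `E` dies on `A`, then `E ⊕ εⁿ` is trivial there for some `n`. It represents the
same class and descends to `Z`. Conversely, `f ∘ i` is constant. -/
theorem exact_map_of_subsingleton [CompactSpace A] [CompactSpace Y] [T2Space Y] [T2Space Z]
    [Subsingleton P] [Nonempty P] (h : IsCollapse i f j) :
    Function.Exact (RedK.map 𝕜 f) (RedK.map 𝕜 i) := by
  have : CompactSpace Z := h.surjective.compactSpace f.continuous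
  intro z
  constructor
  · obtain ⟨E⟩ := z
    intro hz
    obtain ⟨n, m, e⟩ := RedK.mk_eq_zero.1 hz
    obtain ⟨F, hF⟩ := h.exists_isIso_pullback (E.sum (VectorBundle.trivial 𝕜 Y n))
      ((VectorBundle.pullback_sum i _ _).trans <|
        ((VectorBundle.IsIso.refl _).sum (VectorBundle.pullback_trivial i n)).trans e)
    exact ⟨RedK.mk F, RedK.mk_eq_mk.2 (hF.stablyEquiv.trans (E.sum_trivial_stablyEquiv n))⟩
  · rintro ⟨y, rfl⟩
    rw [← RedK.map_comp]
    obtain ⟨a, -⟩ := h.exists_apply_eq (Classical.arbitrary P)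
    refine RedK.map_eq_zero_of_nullhomotopic ⟨f (i a), ?_⟩ y
    rw [show f.comp i = .const A (f (i a)) from ContinuousMap.ext fun b => h.apply_eq b a]

/-- This reduces a contractible center to a point: collapsing the center further does not change the
reduced K-group. -/
theorem bijective_map_mk_range [CompactSpace Z] [T2Space Z] [CompactSpace P]
    (hj : Function.Injective j) (hP : (ContinuousMap.id P).Nullhomotopic) :
    Function.Bijective (RedK.map 𝕜 (Collapse.mk (Set.range j))) := by
  have : T2Space (Collapse (Set.range j)) :=
    Collapse.t2Space (isCompact_range j.continuous).isClosed
  obtain ⟨p, -⟩ := id hP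
  exact (isCollapse_mk j hj rfl p).bijective_map_of_subsingleton hP

variable [CompactSpace A] [CompactSpace Y] [T2Space Y] [T2Space Z] [CompactSpace P]

/-- Collapsing onto a contractible subspace: the maps of reduced K-groups are exact. -/
theorem exact_map (h : IsCollapse i f j) (hP : (ContinuousMap.id P).Nullhomotopic) :
    Function.Exact (RedK.map 𝕜 f) (RedK.map 𝕜 i) := by
  have : CompactSpace Z := h.surjective.compactSpace f.continuous
  have : T2Space (Collapse (Set.range j)) :=
    Collapse.t2Space (isCompact_range j.continuous).isClosed
  have hb := bijective_map_mk_range (𝕜 := 𝕜) h.injective_center hP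
  obtain ⟨p, -⟩ := hP
  intro z
  refine ((h.comp_mk p).exact_map_of_subsingleton (𝕜 := 𝕜) z).trans ⟨?_, ?_⟩
  · rintro ⟨y, rfl⟩
    exact ⟨_, (RedK.map_comp _ _ _).symm⟩
  · rintro ⟨y, rfl⟩
    obtain ⟨x, rfl⟩ := hb.2 y
    exact ⟨x, RedK.map_comp _ _ _⟩

/-- Collapsing a contractible subspace onto a contractible subspace: the map of reduced K-groups is
bijective. -/
theorem bijective_map (h : IsCollapse i f j) (hP : (ContinuousMap.id P).Nullhomotopic)
    (hA : (ContinuousMap.id A).Nullhomotopic) : Function.Bijective (RedK.map 𝕜 f) := by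
  have : CompactSpace Z := h.surjective.compactSpace f.continuous
  have : T2Space (Collapse (Set.range j)) :=
    Collapse.t2Space (isCompact_range j.continuous).isClosed
  have hb := bijective_map_mk_range (𝕜 := 𝕜) h.injective_center hP
  obtain ⟨p, -⟩ := hP
  have hc := (h.comp_mk p).bijective_map_of_subsingleton (𝕜 := 𝕜) hA
  have he : ⇑(RedK.map 𝕜 ((Collapse.mk (Set.range j)).comp f)) =
      RedK.map 𝕜 f ∘ RedK.map 𝕜 (Collapse.mk (Set.range j)) :=
    funext fun z => RedK.map_comp _ _ _
  rw [he] at hc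
  exact (Function.Bijective.of_comp_iff _ hb).1 hc

end IsCollapse

end Main

/-! ### Suspensions -/

/-- A homotopy can be given on the source of a surjection of compact Hausdorff spaces. -/
theorem homotopic_of_surjective {T D E : Type*} [TopologicalSpace T] [TopologicalSpace D]
    [TopologicalSpace E] [CompactSpace T] [T2Space D] (k : C(T, D)) (hk : Function.Surjective k)
    {f g : C(D, E)} (h : C(T × unitInterval, E)) (h0 : ∀ t, h (t, 0) = f (k t))
    (h1 : ∀ t, h (t, 1) = g (k t)) (hc : ∀ t t' s, k t = k t' → h (t, s) = h (t', s)) :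
    f.Homotopic g := by
  let k' : C(T × unitInterval, D × unitInterval) := k.prodMap (.id _)
  have hk' : Function.Surjective k' := hk.prodMap Function.surjective_id
  -- The product of `k` with the interval is again a surjection from a compact onto a Hausdorff
  -- space, hence a quotient map.
  have hq := IsQuotientMap.of_surjective_continuous hk' k'.continuous
  have hf : Function.FactorsThrough h k' := by
    rintro ⟨t, s⟩ ⟨t', s'⟩ e
    obtain ⟨e, rfl : s = s'⟩ := Prod.ext_iff.1 e
    exact hc _ _ _ e
  have hl : ∀ t s, hq.lift h hf (k t, s) = h (t, s) := fun t s =>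
    DFunLike.congr_fun (hq.lift_comp h hf) (t, s)
  refine ⟨⟨(hq.lift h hf).comp ⟨Prod.swap, continuous_swap⟩, fun x => ?_, fun x => ?_⟩⟩ <;>
    obtain ⟨t, rfl⟩ := hk x
  · exact (hl t 0).trans (h0 t)
  · exact (hl t 1).trans (h1 t)

section Suspension

variable {X : Type u} [TopologicalSpace X] {Y : Type v} [TopologicalSpace Y] {Z : Type w}
  [TopologicalSpace Z]

theorem Susp.map_mk (f : C(X, Y)) (p : X × unitInterval) :
    Susp.map f (Susp.mk X p) = Susp.mk Y (f p.1, p.2) := rfl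

theorem Susp.map_comp (f : C(X, Y)) (g : C(Y, Z)) :
    Susp.map (g.comp f) = (Susp.map g).comp (Susp.map f) := by
  ext x
  obtain ⟨p, rfl⟩ := Susp.surjective_mk x
  rfl

theorem Susp.map_id : Susp.map (ContinuousMap.id X) = ContinuousMap.id (Susp X) := by
  ext x
  obtain ⟨p, rfl⟩ := Susp.surjective_mk x
  rfl

theorem Susp.map_homotopic [CompactSpace X] [T2Space X] {f g : C(X, Y)} (h : f.Homotopic g) :
    (Susp.map f).Homotopic (Susp.map g) := by
  obtain ⟨H⟩ := h
  refine homotopic_of_surjective (Susp.mk X) Susp.surjective_mk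
    ⟨fun p => Susp.mk Y (H (p.2, p.1.1), p.1.2), by fun_prop⟩ (fun t => ?_) (fun t => ?_) ?_
  · simp [Susp.map_mk]
  · simp [Susp.map_mk]
  · rintro t t' s e
    obtain rfl | e := Susp.mk_eq_mk.1 e
    · rfl
    · exact Susp.mk_eq_mk.2 (.inr e)

/-- The suspension of a constant map has its image in the segment over one point and need not be
constant. A second homotopy slides that segment down to the pole at height `0`. -/
theorem Susp.map_nullhomotopic [CompactSpace X] [T2Space X] {f : C(X, Y)} (h : f.Nullhomotopic) :
    (Susp.map f).Nullhomotopic := by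
  obtain ⟨y, hy⟩ := h
  refine ⟨Susp.mk Y (y, 0), (Susp.map_homotopic hy).trans ?_⟩
  refine homotopic_of_surjective (Susp.mk X) Susp.surjective_mk
    ⟨fun p => Susp.mk Y (y, p.1.2 * unitInterval.symm p.2), by fun_prop⟩
    (fun t => ?_) (fun t => ?_) ?_
  · simp [Susp.map_mk]
  · simp
  · rintro t t' s e
    obtain rfl | e | e := Susp.mk_eq_mk.1 e
    · rfl
    · simp [e]
    · simp [e]

theorem IterSusp.map_comp (n : ℕ) {X : Type u} [TopologicalSpace X] {Y : Type v}
    [TopologicalSpace Y] {Z : Type w} [TopologicalSpace Z] (f : C(X, Y)) (g : C(Y, Z)) :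
    IterSusp.map n (g.comp f) = (IterSusp.map n g).comp (IterSusp.map n f) := by
  induction n generalizing X Y Z with
  | zero => rfl
  | succ n ih => exact (congrArg (IterSusp.map n) (Susp.map_comp f g)).trans (ih _ _)

theorem IterSusp.map_id (n : ℕ) {X : Type u} [TopologicalSpace X] :
    IterSusp.map n (ContinuousMap.id X) = ContinuousMap.id (IterSusp n X) := by
  induction n generalizing X with
  | zero => rfl
  | succ n ih => exact (congrArg (IterSusp.map n) Susp.map_id).trans ih

theorem IterSusp.map_homotopic (n : ℕ) {X : Type u} [TopologicalSpace X] [CompactSpace X]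
    [T2Space X] {Y : Type v} [TopologicalSpace Y] {f g : C(X, Y)} (h : f.Homotopic g) :
    (IterSusp.map n f).Homotopic (IterSusp.map n g) := by
  induction n generalizing X Y with
  | zero => exact h
  | succ n ih => exact ih (Susp.map_homotopic h)

theorem IterSusp.map_nullhomotopic (n : ℕ) {X : Type u} [TopologicalSpace X] [CompactSpace X]
    [T2Space X] {Y : Type v} [TopologicalSpace Y] {f : C(X, Y)} (h : f.Nullhomotopic) :
    (IterSusp.map n f).Nullhomotopic := by
  induction n generalizing X Y with
  | zero => exact h
  | succ n ih => exact ih (Susp.map_nullhomotopic h)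

theorem IterSusp.id_nullhomotopic (n : ℕ) [CompactSpace X] [T2Space X]
    (h : (ContinuousMap.id X).Nullhomotopic) :
    (ContinuousMap.id (IterSusp n X)).Nullhomotopic := by
  rw [← IterSusp.map_id]
  exact IterSusp.map_nullhomotopic n h

instance (n : ℕ) [CompactSpace X] : CompactSpace (IterSusp n X) := IterSusp.compactSpace n X

instance (n : ℕ) [CompactSpace X] [T2Space X] : T2Space (IterSusp n X) := IterSusp.t2Space n X

theorem Susp.map_injective {f : C(X, Y)} (hf : Function.Injective f) :
    Function.Injective (Susp.map f) := by
  intro x y h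
  obtain ⟨⟨x, t⟩, rfl⟩ := Susp.surjective_mk x
  obtain ⟨⟨y, s⟩, rfl⟩ := Susp.surjective_mk y
  obtain h | h := Susp.mk_eq_mk.1 h
  · simp only [Prod.mk.injEq] at h
    rw [hf h.1, h.2]
  · exact Susp.mk_eq_mk.2 (.inr h)

/-- With this definition the suspension of the empty space is empty, so the poles lie in the image
only when `X` has a point. -/
theorem Susp.mk_mem_range_map {f : C(X, Y)} (y : Y) (t : unitInterval) :
    Susp.mk Y (y, t) ∈ Set.range (Susp.map f) ↔
      Nonempty X ∧ (t = 0 ∨ t = 1 ∨ y ∈ Set.range f) := by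
  constructor
  · rintro ⟨x, h⟩
    obtain ⟨⟨x, s⟩, rfl⟩ := Susp.surjective_mk x
    refine ⟨⟨x⟩, ?_⟩
    obtain h | ⟨-, h⟩ | ⟨-, h⟩ := Susp.mk_eq_mk.1 h
    · exact .inr (.inr ⟨x, (Prod.ext_iff.1 h).1⟩)
    · exact .inl h
    · exact .inr (.inl h)
  · rintro ⟨⟨x⟩, h | h | ⟨x', rfl⟩⟩
    · exact ⟨Susp.mk X (x, 0), Susp.mk_eq_mk.2 (.inr (.inl ⟨rfl, h⟩))⟩
    · exact ⟨Susp.mk X (x, 1), Susp.mk_eq_mk.2 (.inr (.inr ⟨rfl, h⟩))⟩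
    · exact ⟨Susp.mk X (x', t), rfl⟩

/-- A suspended collapse to a point is a collapse onto a segment, which is why the center is a space
`P`. A point of `P` yields one of `X`, and this puts the poles into both images. -/
theorem IsCollapse.susp {P : Type*} [TopologicalSpace P] [Nonempty P] {i : C(X, Y)} {f : C(Y, Z)}
    {j : C(P, Z)} (h : IsCollapse i f j) :
    IsCollapse (Susp.map i) (Susp.map f) (Susp.map j) where
  injective_incl := Susp.map_injective h.injective_incl
  surjective z := by
    obtain ⟨⟨z, t⟩, rfl⟩ := Susp.surjective_mk z
    obtain ⟨y, rfl⟩ := h.surjective z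
    exact ⟨Susp.mk Y (y, t), rfl⟩
  injective_center := Susp.map_injective h.injective_center
  mem_range_iff y := by
    obtain ⟨⟨y, t⟩, rfl⟩ := Susp.surjective_mk y
    have : Nonempty X := ⟨(h.exists_apply_eq (Classical.arbitrary P)).choose⟩
    rw [Susp.map_mk, Susp.mk_mem_range_map, Susp.mk_mem_range_map, h.mem_range_iff]
    simp_all
  eq_or y y' hy := by
    obtain ⟨⟨y, t⟩, rfl⟩ := Susp.surjective_mk y
    obtain ⟨⟨y', t'⟩, rfl⟩ := Susp.surjective_mk y'
    have : Nonempty X := ⟨(h.exists_apply_eq (Classical.arbitrary P)).choose⟩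
    obtain e | e := Susp.mk_eq_mk.1 hy
    · simp only [Prod.mk.injEq] at e
      obtain ⟨e, rfl⟩ := e
      obtain rfl | hy := h.eq_or y y' e
      · exact .inl rfl
      · exact .inr ⟨(Susp.mk_mem_range_map y t).2 ⟨this, .inr (.inr hy.1)⟩,
          (Susp.mk_mem_range_map y' t).2 ⟨this, .inr (.inr hy.2)⟩⟩
    · exact .inl (Susp.mk_eq_mk.2 (.inr e))

theorem IsCollapse.iterSusp (n : ℕ) {X : Type u} [TopologicalSpace X] {Y : Type v}
    [TopologicalSpace Y] {Z : Type w} [TopologicalSpace Z] {P : Type*} [TopologicalSpace P]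
    [Nonempty P] {i : C(X, Y)} {f : C(Y, Z)} {j : C(P, Z)} (h : IsCollapse i f j) :
    IsCollapse (IterSusp.map n i) (IterSusp.map n f) (IterSusp.map n j) := by
  induction n generalizing X Y Z P with
  | zero => exact h
  | succ n ih =>
    have : Nonempty (Susp P) := ⟨Susp.mk P (Classical.arbitrary P, 0)⟩
    exact ih h.susp

end Suspension

/-! ### The spaces `X ∪ CA` and `CX ∪ CA` -/

section Cones

variable {X : Type u} [TopologicalSpace X]

namespace ConeAttach

/-- The inclusion `X → X ∪ CA`. -/
def inl (A : Set X) : C(X, ConeAttach A) :=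
  ⟨fun x => Quotient.mk _ (.inl x), continuous_quotient_mk'.comp continuous_inl⟩

/-- The map from the cylinder on `A` to `X ∪ CA`. -/
def inr (A : Set X) : C(A × unitInterval, ConeAttach A) :=
  ⟨fun p => Quotient.mk _ (.inr p), continuous_quotient_mk'.comp continuous_inr⟩

variable {A : Set X}

theorem mk_eq_mk {X : Type u} {A : Set X} {z w : X ⊕ (A × unitInterval)} :
    (Quotient.mk _ z : ConeAttach A) = Quotient.mk _ w ↔
      coneAux A z = coneAux A w ∨ ((coneAux A z).2 = 1 ∧ (coneAux A w).2 = 1) :=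
  Quotient.eq (r := coneSetoid A)

theorem inl_eq_inl {x y : X} : inl A x = inl A y ↔ x = y := by
  refine mk_eq_mk.trans ?_
  simp [coneAux]

theorem inl_eq_inr {x : X} {p : A × unitInterval} : inl A x = inr A p ↔ x = p.1 ∧ p.2 = 0 := by
  refine mk_eq_mk.trans ?_
  simp only [coneAux, Sum.elim_inl, Sum.elim_inr, Prod.mk.injEq, zero_ne_one, false_and, or_false]
  exact and_congr_right' eq_comm

theorem inr_eq_inr {p q : A × unitInterval} :
    inr A p = inr A q ↔ p = q ∨ (p.2 = 1 ∧ q.2 = 1) := by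
  obtain ⟨⟨x, hx⟩, s⟩ := p
  obtain ⟨⟨y, hy⟩, t⟩ := q
  refine mk_eq_mk.trans ?_
  simp [coneAux]

theorem eq_inl_or_inr (w : ConeAttach A) : (∃ x, w = inl A x) ∨ ∃ p, w = inr A p := by
  obtain ⟨x | p, rfl⟩ := Quotient.exists_rep w
  exacts [.inl ⟨x, rfl⟩, .inr ⟨p, rfl⟩]

theorem toCollapse_inl (x : X) : toCollapse A (inl A x) = Collapse.mk A x := rfl

theorem toCollapse_inr (p : A × unitInterval) : toCollapse A (inr A p) = Collapse.mk A p.1.1 := rfl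

theorem toCollapse_comp_inl : (toCollapse A).comp (inl A) = Collapse.mk A := rfl

variable [Nonempty A]

theorem toSusp_inl (x : X) : toSusp A (inl A x) = Susp.mk A (Classical.arbitrary A, 0) := rfl

theorem toSusp_inr (p : A × unitInterval) : toSusp A (inr A p) = Susp.mk A p := rfl

/-- `X ∪ CA → SA` collapses `X` to a point. -/
theorem isCollapse_toSusp (A : Set X) [Nonempty A] :
    IsCollapse (inl A) (toSusp A) (.const Unit (Susp.mk A (Classical.arbitrary A, 0))) where
  injective_incl _ _ h := inl_eq_inl.1 h
  surjective z := by
    obtain ⟨p, rfl⟩ := Susp.surjective_mk z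
    exact ⟨inr A p, rfl⟩
  injective_center _ _ _ := rfl
  mem_range_iff w := by
    obtain ⟨x, rfl⟩ | ⟨p, rfl⟩ := eq_inl_or_inr w
    · simp [toSusp_inl]
    · simp only [toSusp_inr, Set.mem_range, ContinuousMap.const_apply, exists_const, inl_eq_inr,
        Susp.mk_eq_mk, exists_eq_left, true_and]
      grind
  eq_or w w' h := by
    obtain ⟨x, rfl⟩ | ⟨p, rfl⟩ := eq_inl_or_inr w <;>
      obtain ⟨x', rfl⟩ | ⟨p', rfl⟩ := eq_inl_or_inr w'
    · simp
    · simp only [toSusp_inl, toSusp_inr, Susp.mk_eq_mk, Set.mem_range, inl_eq_inr, inl_eq_inl] at h ⊢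
      grind
    · simp only [toSusp_inl, toSusp_inr, Susp.mk_eq_mk, Set.mem_range, inl_eq_inr, inl_eq_inl] at h ⊢
      grind
    · simp only [toSusp_inr, Susp.mk_eq_mk, Set.mem_range, inl_eq_inr, inr_eq_inr] at h ⊢
      grind

/-- `X ∪ CA → X / A` collapses `CA` to a point. -/
theorem isCollapse_toCollapse (A : Set X) [Nonempty A] :
    IsCollapse (incl (Set.range (inr A))) (toCollapse A)
      (.const Unit (Collapse.mk A (Classical.arbitrary A).1)) where
  injective_incl := Subtype.val_injective
  surjective z := by
    obtain ⟨x, rfl⟩ := Collapse.surjective_mk A z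
    exact ⟨inl A x, rfl⟩
  injective_center _ _ _ := rfl
  mem_range_iff w := by
    have ha := (Classical.arbitrary A).2
    rw [show Set.range (incl (Set.range (inr A))) = Set.range (inr A) from Subtype.range_val]
    obtain ⟨x, rfl⟩ | ⟨p, rfl⟩ := eq_inl_or_inr w
    · simp only [toCollapse_inl, Set.mem_range, ContinuousMap.const_apply, exists_const,
        eq_comm (b := inl A x), inl_eq_inr, Collapse.mk_eq_mk]
      constructor
      · rintro (h | h)
        · exact ⟨⟨⟨x, h ▸ ha⟩, 0⟩, rfl, rfl⟩
        · exact ⟨⟨⟨x, h.2⟩, 0⟩, rfl, rfl⟩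
      · rintro ⟨p, rfl, -⟩
        exact .inr ⟨ha, p.1.2⟩
    · simp [toCollapse_inr, Collapse.mk_eq_mk]
  eq_or w w' h := by
    rw [show Set.range (incl (Set.range (inr A))) = Set.range (inr A) from Subtype.range_val]
    have hr : ∀ x ∈ A, inl A x ∈ Set.range (inr A) := fun x hx =>
      ⟨(⟨x, hx⟩, 0), (inl_eq_inr.2 ⟨rfl, rfl⟩).symm⟩
    obtain ⟨x, rfl⟩ | ⟨p, rfl⟩ := eq_inl_or_inr w <;>
      obtain ⟨x', rfl⟩ | ⟨p', rfl⟩ := eq_inl_or_inr w'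
    · obtain h | h := Collapse.mk_eq_mk.1 h
      · exact .inl (inl_eq_inl.2 h)
      · exact .inr ⟨hr x h.1, hr x' h.2⟩
    · obtain h | h := Collapse.mk_eq_mk.1 h
      · exact .inr ⟨hr x (h ▸ p'.1.2), _, rfl⟩
      · exact .inr ⟨hr x h.1, _, rfl⟩
    · obtain h | h := Collapse.mk_eq_mk.1 h
      · exact .inr ⟨⟨_, rfl⟩, hr x' (h ▸ p.1.2)⟩
      · exact .inr ⟨⟨_, rfl⟩, hr x' h.2⟩
    · exact .inr ⟨⟨_, rfl⟩, ⟨_, rfl⟩⟩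

/-- Replacing the height `t` by `max t s` pushes the cone up to its apex. -/
theorem cone_nullhomotopic [CompactSpace X] [T2Space X] (hA : IsClosed A) :
    (ContinuousMap.id (Set.range (inr A))).Nullhomotopic := by
  have := isCompact_iff_compactSpace.1 hA.isCompact
  have := ConeAttach.t2Space hA
  let k : C(A × unitInterval, Set.range (inr A)) := ⟨fun p => ⟨inr A p, p, rfl⟩, by fun_prop⟩
  refine ⟨k (Classical.arbitrary A, 1), homotopic_of_surjective k ?_
    ⟨fun z => k (z.1.1, max z.1.2 z.2), by fun_prop⟩ (fun p => ?_) (fun p => ?_) ?_⟩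
  · rintro ⟨_, p, rfl⟩
    exact ⟨p, rfl⟩
  · simp
  · exact Subtype.ext (inr_eq_inr.2 (.inr (by simp [unitInterval.le_one'])))
  · rintro p q s e
    obtain rfl | e := inr_eq_inr.1 (congrArg Subtype.val e)
    · rfl
    · exact Subtype.ext (inr_eq_inr.2 (.inr (by simp [e, unitInterval.le_one'])))

/-- The composition `X ∪ CA → SA → SX` is nullhomotopic. -/
theorem map_incl_comp_toSusp_nullhomotopic [CompactSpace X] [T2Space X] (hA : IsClosed A) :
    ((Susp.map (incl A)).comp (toSusp A)).Nullhomotopic := by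
  have := isCompact_iff_compactSpace.1 hA.isCompact
  have := ConeAttach.t2Space hA
  have hc : Continuous (coneAux A) := by
    unfold coneAux
    fun_prop
  let k : C(X ⊕ (A × unitInterval), ConeAttach A) := ⟨Quotient.mk _, continuous_quotient_mk'⟩
  -- All heights are raised to at least `s`. At time `0` the copy of `X` lies at height `0`, a
  -- single point of `SX`; afterwards it sweeps through the whole of `SX`, so the target must be
  -- `SX` and not `SA`.
  refine ⟨Susp.mk X ((Classical.arbitrary A).1, 1), homotopic_of_surjective k Quotient.mk_surjective
    ⟨fun z => Susp.mk X ((coneAux A z.1).1, max (coneAux A z.1).2 z.2), by fun_prop⟩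
    (fun z => ?_) (fun z => ?_) fun z w s e => ?_⟩
  · rcases z with x | p
    · exact Susp.mk_eq (.inr (.inl ⟨by simp [coneAux], rfl⟩))
    · exact Susp.mk_eq (.inl (by simp [coneAux, incl]))
  · exact Susp.mk_eq (.inr (.inr ⟨by simp [unitInterval.le_one'], rfl⟩))
  · obtain e | e := mk_eq_mk.1 e
    · simp [e]
    · exact Susp.mk_eq (.inr (.inr ⟨by simp [e, unitInterval.le_one'],
        by simp [e, unitInterval.le_one']⟩))

end ConeAttach

/-- The point halfway between `0` and `t`. -/
def lowerHalf (t : unitInterval) : unitInterval := ⟨t / 2, by linarith [t.2.1], by linarith [t.2.2]⟩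

/-- The point halfway between `t` and `1`. -/
def upperHalf (t : unitInterval) : unitInterval :=
  ⟨(1 + t) / 2, by linarith [t.2.1], by linarith [t.2.2]⟩

theorem continuous_lowerHalf : Continuous lowerHalf := by
  unfold lowerHalf
  fun_prop

theorem continuous_upperHalf : Continuous upperHalf := by
  unfold upperHalf
  fun_prop

/-- The map from the disjoint union of `X × [0, 1]` and `A × [0, 1]` to `X × [0, 1]` that places
the first in the lower and the second in the upper half. -/
def doubleConeAux (A : Set X) : (X × unitInterval) ⊕ (A × unitInterval) → X × unitInterval :=
  Sum.elim (fun p => (p.1, lowerHalf p.2)) (fun p => (p.1.1, upperHalf p.2))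

/-- The space `CX ∪ CA`: the part of the suspension of `X` that consists of the lower cone on `X`
and the upper cone on `A`. -/
def DoubleCone (A : Set X) : Type u := Quotient ((suspSetoid X).comap (doubleConeAux A))

namespace DoubleCone

instance (A : Set X) : TopologicalSpace (DoubleCone A) :=
  inferInstanceAs (TopologicalSpace (Quotient ((suspSetoid X).comap (doubleConeAux A))))

theorem compactSpace [CompactSpace X] {A : Set X} (hA : IsClosed A) :
    CompactSpace (DoubleCone A) :=
  have : CompactSpace A := isCompact_iff_compactSpace.1 hA.isCompact
  inferInstanceAs (CompactSpace (Quotient ((suspSetoid X).comap (doubleConeAux A))))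

theorem t2Space [CompactSpace X] [T2Space X] {A : Set X} (hA : IsClosed A) :
    T2Space (DoubleCone A) := by
  have : CompactSpace A := isCompact_iff_compactSpace.1 hA.isCompact
  have hc : Continuous (doubleConeAux A) := by
    have := continuous_lowerHalf
    have := continuous_upperHalf
    unfold doubleConeAux
    fun_prop
  refine t2Space_quotient _ (IsClosed.preimage (hc.prodMap hc)
    (t := {p : (X × unitInterval) × (X × unitInterval) | suspSetoid X p.1 p.2}) ?_)
  have h (c : unitInterval) : IsClosed {q : (X × unitInterval) × (X × unitInterval) |
      q.1.2 = c ∧ q.2.2 = c} :=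
    (isClosed_eq (by fun_prop) continuous_const).inter (isClosed_eq (by fun_prop) continuous_const)
  exact (isClosed_eq continuous_fst continuous_snd).union ((h 0).union (h 1))

/-- The quotient map. -/
def mk (A : Set X) : C((X × unitInterval) ⊕ (A × unitInterval), DoubleCone A) :=
  ⟨Quotient.mk _, continuous_quotient_mk'⟩

variable {A : Set X}

theorem surjective_mk : Function.Surjective (mk A) := Quotient.mk_surjective

theorem mk_eq_mk {z w : (X × unitInterval) ⊕ (A × unitInterval)} :
    mk A z = mk A w ↔ suspSetoid X (doubleConeAux A z) (doubleConeAux A w) :=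
  Quotient.eq (r := (suspSetoid X).comap (doubleConeAux A))

/-- The lower half never reaches height `1` and the upper half never reaches height `0`. Each half
therefore sees one pole, and they meet only at height one half. -/
theorem inl_eq_inl {p q : X × unitInterval} :
    mk A (.inl p) = mk A (.inl q) ↔ p = q ∨ (p.2 = 0 ∧ q.2 = 0) := by
  obtain ⟨x, s, hs₀, hs₁⟩ := p
  obtain ⟨y, t, ht₀, ht₁⟩ := q
  refine mk_eq_mk.trans (show (_ ∨ _) ↔ _ from ?_)
  simp only [doubleConeAux, Sum.elim_inl, lowerHalf, Prod.mk.injEq, Subtype.ext_iff,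
    Set.Icc.coe_zero, Set.Icc.coe_one]
  grind

theorem inl_eq_inr {p : X × unitInterval} {q : A × unitInterval} :
    mk A (.inl p) = mk A (.inr q) ↔ p.1 = q.1 ∧ p.2 = 1 ∧ q.2 = 0 := by
  obtain ⟨x, s, hs₀, hs₁⟩ := p
  obtain ⟨y, t, ht₀, ht₁⟩ := q
  refine mk_eq_mk.trans (show (_ ∨ _) ↔ _ from ?_)
  simp only [doubleConeAux, Sum.elim_inl, Sum.elim_inr, lowerHalf, upperHalf, Prod.mk.injEq,
    Subtype.ext_iff, Set.Icc.coe_zero, Set.Icc.coe_one]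
  grind

theorem inr_eq_inr {p q : A × unitInterval} :
    mk A (.inr p) = mk A (.inr q) ↔ p = q ∨ (p.2 = 1 ∧ q.2 = 1) := by
  obtain ⟨⟨x, hx⟩, s, hs₀, hs₁⟩ := p
  obtain ⟨⟨y, hy⟩, t, ht₀, ht₁⟩ := q
  refine mk_eq_mk.trans (show (_ ∨ _) ↔ _ from ?_)
  simp only [doubleConeAux, Sum.elim_inr, upperHalf, Prod.mk.injEq,
    Set.Icc.coe_zero, Set.Icc.coe_one, Subtype.ext_iff]
  grind

/-- The inclusion `X ∪ CA → CX ∪ CA`. -/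
def ofConeAttach (A : Set X) : C(ConeAttach A, DoubleCone A) where
  toFun := Quotient.lift (Sum.elim (fun x => mk A (.inl (x, 1))) (fun p => mk A (.inr p))) (by
    rintro (x | p) (y | q) h
    · obtain rfl := ConeAttach.inl_eq_inl.1 (Quotient.sound (s := coneSetoid A) h)
      rfl
    · obtain ⟨h, h'⟩ := ConeAttach.inl_eq_inr.1 (Quotient.sound (s := coneSetoid A) h)
      exact inl_eq_inr.2 ⟨h, rfl, h'⟩
    · obtain ⟨h, h'⟩ := ConeAttach.inl_eq_inr.1 (Quotient.sound (s := coneSetoid A) h).symm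
      exact (inl_eq_inr.2 ⟨h, rfl, h'⟩).symm
    · exact inr_eq_inr.2 (ConeAttach.inr_eq_inr.1 (Quotient.sound (s := coneSetoid A) h)))
  continuous_toFun := Continuous.quotient_lift (by fun_prop) _

theorem ofConeAttach_inl (x : X) : ofConeAttach A (ConeAttach.inl A x) = mk A (.inl (x, 1)) := rfl

theorem ofConeAttach_inr (p : A × unitInterval) :
    ofConeAttach A (ConeAttach.inr A p) = mk A (.inr p) := rfl

/-- The map `CX ∪ CA → SX` that collapses `CA`. -/
def toSusp (A : Set X) : C(DoubleCone A, Susp X) where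
  toFun := Quotient.lift (Sum.elim (fun p => Susp.mk X p) (fun p => Susp.mk X (p.1.1, 1))) (by
    rintro (p | p) (q | q) h
    · obtain rfl | h := inl_eq_inl.1 (Quotient.sound h : mk A _ = mk A _)
      · rfl
      · exact Susp.mk_eq (.inr (.inl h))
    · obtain ⟨-, h, -⟩ := inl_eq_inr.1 (Quotient.sound h : mk A _ = mk A _)
      exact Susp.mk_eq (.inr (.inr ⟨h, rfl⟩))
    · obtain ⟨-, h, -⟩ := inl_eq_inr.1 (Quotient.sound h : mk A _ = mk A _).symm
      exact Susp.mk_eq (.inr (.inr ⟨rfl, h⟩))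
    · exact Susp.mk_eq (.inr (.inr ⟨rfl, rfl⟩)))
  continuous_toFun := Continuous.quotient_lift (by fun_prop) _

theorem toSusp_inl (p : X × unitInterval) : toSusp A (mk A (.inl p)) = Susp.mk X p := rfl

theorem toSusp_inr (p : A × unitInterval) :
    toSusp A (mk A (.inr p)) = Susp.mk X (p.1.1, 1) := rfl

variable [Nonempty A]

/-- The map `CX ∪ CA → SA` that collapses `CX`. -/
def toSuspSub (A : Set X) [Nonempty A] : C(DoubleCone A, Susp A) where
  toFun := Quotient.lift
    (Sum.elim (fun _ => Susp.mk A (Classical.arbitrary A, 0)) (fun p => Susp.mk A p)) (by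
    rintro (p | p) (q | q) h
    · rfl
    · obtain ⟨-, -, h⟩ := inl_eq_inr.1 (Quotient.sound h : mk A _ = mk A _)
      exact Susp.mk_eq (.inr (.inl ⟨rfl, h⟩))
    · obtain ⟨-, -, h⟩ := inl_eq_inr.1 (Quotient.sound h : mk A _ = mk A _).symm
      exact Susp.mk_eq (.inr (.inl ⟨h, rfl⟩))
    · obtain rfl | h := inr_eq_inr.1 (Quotient.sound h : mk A _ = mk A _)
      · rfl
      · exact Susp.mk_eq (.inr (.inr h)))
  continuous_toFun := Continuous.quotient_lift (by fun_prop) _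

theorem toSuspSub_inr (p : A × unitInterval) : toSuspSub A (mk A (.inr p)) = Susp.mk A p := rfl

theorem toSuspSub_comp_ofConeAttach :
    (toSuspSub A).comp (ofConeAttach A) = ConeAttach.toSusp A := by
  ext w
  obtain ⟨x, rfl⟩ | ⟨p, rfl⟩ := ConeAttach.eq_inl_or_inr w <;> rfl

/-- `CX ∪ CA → SX` collapses `X ∪ CA` to a point. -/
theorem isCollapse_toSusp (A : Set X) [Nonempty A] :
    IsCollapse (ofConeAttach A) (toSusp A)
      (.const Unit (Susp.mk X ((Classical.arbitrary A).1, 1))) where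
  injective_incl w w' h := by
    obtain ⟨x, rfl⟩ | ⟨p, rfl⟩ := ConeAttach.eq_inl_or_inr w <;>
      obtain ⟨x', rfl⟩ | ⟨p', rfl⟩ := ConeAttach.eq_inl_or_inr w'
    · rw [ofConeAttach_inl, ofConeAttach_inl, inl_eq_inl] at h
      rw [ConeAttach.inl_eq_inl]
      simpa using h
    · rw [ofConeAttach_inl, ofConeAttach_inr, inl_eq_inr] at h
      exact ConeAttach.inl_eq_inr.2 ⟨h.1, h.2.2⟩
    · rw [ofConeAttach_inl, ofConeAttach_inr, eq_comm, inl_eq_inr] at h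
      exact (ConeAttach.inl_eq_inr.2 ⟨h.1, h.2.2⟩).symm
    · rw [ofConeAttach_inr, ofConeAttach_inr, inr_eq_inr] at h
      exact ConeAttach.inr_eq_inr.2 h
  surjective z := by
    obtain ⟨p, rfl⟩ := Susp.surjective_mk z
    exact ⟨mk A (.inl p), rfl⟩
  injective_center _ _ _ := rfl
  mem_range_iff w := by
    obtain ⟨p | p, rfl⟩ := surjective_mk w
    · constructor
      · rintro ⟨⟨⟩, h⟩
        have h2 : p.2 = 1 := by
          obtain h | h | h := Susp.mk_eq_mk.1 h
          · exact (congrArg Prod.snd h).symm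
          · exact absurd h.1 one_ne_zero
          · exact h.2
        exact ⟨ConeAttach.inl A p.1, inl_eq_inl.2 (.inl (Prod.ext rfl h2.symm))⟩
      · rintro ⟨w, h⟩
        refine ⟨(), Susp.mk_eq (.inr (.inr ⟨rfl, ?_⟩))⟩
        obtain ⟨x, rfl⟩ | ⟨q, rfl⟩ := ConeAttach.eq_inl_or_inr w
        · obtain h | h := inl_eq_inl.1 h
          · exact (congrArg Prod.snd h).symm
          · exact absurd h.1 one_ne_zero
        · exact (inl_eq_inr.1 h.symm).2.1
    · exact ⟨fun _ => ⟨ConeAttach.inr A p, rfl⟩,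
        fun _ => ⟨(), Susp.mk_eq (.inr (.inr ⟨rfl, rfl⟩))⟩⟩
  eq_or w w' h := by
    have hr : ∀ p : X × unitInterval, p.2 = 1 → mk A (.inl p) ∈ Set.range (ofConeAttach A) :=
      fun p hp => ⟨ConeAttach.inl A p.1, inl_eq_inl.2 (.inl (Prod.ext rfl hp.symm))⟩
    have hr' : ∀ p, mk A (.inr p) ∈ Set.range (ofConeAttach A) := fun p => ⟨ConeAttach.inr A p, rfl⟩
    obtain ⟨p | p, rfl⟩ := surjective_mk w <;> obtain ⟨q | q, rfl⟩ := surjective_mk w'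
    · obtain h | h | h := Susp.mk_eq_mk.1 h
      · exact .inl (h ▸ rfl)
      · exact .inl (inl_eq_inl.2 (.inr h))
      · exact .inr ⟨hr p h.1, hr q h.2⟩
    · obtain h | h | h := Susp.mk_eq_mk.1 h
      · exact .inr ⟨hr p (congrArg Prod.snd h), hr' q⟩
      · exact absurd h.2 one_ne_zero
      · exact .inr ⟨hr p h.1, hr' q⟩
    · obtain h | h | h := Susp.mk_eq_mk.1 h
      · exact .inr ⟨hr' p, hr q (congrArg Prod.snd h).symm⟩
      · exact absurd h.1 one_ne_zero
      · exact .inr ⟨hr' p, hr q h.2⟩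
    · exact .inr ⟨hr' p, hr' q⟩

/-- The lower cone `CX` in `CX ∪ CA`. -/
abbrev lowerCone (A : Set X) : Set (DoubleCone A) := Set.range fun p => mk A (.inl p)

/-- `CX ∪ CA → SA` collapses `CX` to a point. -/
theorem isCollapse_toSuspSub (A : Set X) [Nonempty A] :
    IsCollapse (incl (lowerCone A)) (toSuspSub A)
      (.const Unit (Susp.mk A (Classical.arbitrary A, 0))) where
  injective_incl := Subtype.val_injective
  surjective z := by
    obtain ⟨p, rfl⟩ := Susp.surjective_mk z
    exact ⟨mk A (.inr p), rfl⟩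
  injective_center _ _ _ := rfl
  mem_range_iff w := by
    rw [show Set.range (incl (lowerCone A)) = lowerCone A from Subtype.range_val]
    obtain ⟨p | p, rfl⟩ := surjective_mk w
    · exact ⟨fun _ => ⟨p, rfl⟩, fun _ => ⟨(), rfl⟩⟩
    · constructor
      · rintro ⟨⟨⟩, h⟩
        refine ⟨(p.1, 1), inl_eq_inr.2 ⟨rfl, rfl, ?_⟩⟩
        obtain h | h | h := Susp.mk_eq_mk.1 h
        · exact (congrArg Prod.snd h).symm
        · exact h.2
        · exact absurd h.1 zero_ne_one
      · rintro ⟨q, h⟩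
        exact ⟨(), Susp.mk_eq (.inr (.inl ⟨rfl, (inl_eq_inr.1 h).2.2⟩))⟩
  eq_or w w' h := by
    rw [show Set.range (incl (lowerCone A)) = lowerCone A from Subtype.range_val]
    have hr : ∀ p : A × unitInterval, p.2 = 0 → mk A (.inr p) ∈ lowerCone A :=
      fun p hp => ⟨(p.1, 1), inl_eq_inr.2 ⟨rfl, rfl, hp⟩⟩
    have hr' : ∀ p, mk A (.inl p) ∈ lowerCone A := fun p => ⟨p, rfl⟩
    obtain ⟨p | p, rfl⟩ := surjective_mk w <;> obtain ⟨q | q, rfl⟩ := surjective_mk w'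
    · exact .inr ⟨hr' p, hr' q⟩
    · obtain h | h | h := Susp.mk_eq_mk.1 h
      · exact .inr ⟨hr' p, hr q (congrArg Prod.snd h).symm⟩
      · exact .inr ⟨hr' p, hr q h.2⟩
      · exact absurd h.1 zero_ne_one
    · obtain h | h | h := Susp.mk_eq_mk.1 h
      · exact .inr ⟨hr p (congrArg Prod.snd h), hr' q⟩
      · exact .inr ⟨hr p h.1, hr' q⟩
      · exact absurd h.2 zero_ne_one
    · obtain h | h | h := Susp.mk_eq_mk.1 h
      · exact .inl (h ▸ rfl)
      · exact .inr ⟨hr p h.1, hr q h.2⟩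
      · exact .inl (inr_eq_inr.2 (.inr h))

/-- Multiplying the height by `1 - s` shrinks the cone to its vertex. -/
theorem lowerCone_nullhomotopic [CompactSpace X] [T2Space X] (hA : IsClosed A) :
    (ContinuousMap.id (lowerCone A)).Nullhomotopic := by
  have := t2Space hA
  let k : C(X × unitInterval, lowerCone A) := ⟨fun p => ⟨mk A (.inl p), p, rfl⟩, by fun_prop⟩
  refine ⟨k ((Classical.arbitrary A).1, 0), homotopic_of_surjective k ?_
    ⟨fun z => k (z.1.1, z.1.2 * unitInterval.symm z.2), by fun_prop⟩ (fun p => ?_) (fun p => ?_) ?_⟩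
  · rintro ⟨_, p, rfl⟩
    exact ⟨p, rfl⟩
  · simp
  · exact Subtype.ext (inl_eq_inl.2 (.inr (by simp)))
  · rintro p q s e
    obtain rfl | e := inl_eq_inl.1 (congrArg Subtype.val e)
    · rfl
    · exact Subtype.ext (inl_eq_inl.2 (.inr (by simp [e])))

/-- The two maps `CX ∪ CA → SX` and `CX ∪ CA → SA → SX` are homotopic. -/
theorem toSusp_homotopic [CompactSpace X] [T2Space X] (hA : IsClosed A) :
    (toSusp A).Homotopic ((Susp.map (incl A)).comp (toSuspSub A)) := by
  have := isCompact_iff_compactSpace.1 hA.isCompact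
  have := t2Space hA
  let x : C((X × unitInterval) ⊕ (A × unitInterval), X) :=
    ⟨Sum.elim (fun p => p.1) (fun p => p.1.1), by fun_prop⟩
  let t₁ : C((X × unitInterval) ⊕ (A × unitInterval), unitInterval) :=
    ⟨Sum.elim (fun p => p.2) (fun _ => 1), by fun_prop⟩
  let t₂ : C((X × unitInterval) ⊕ (A × unitInterval), unitInterval) :=
    ⟨Sum.elim (fun _ => 0) (fun p => p.2), by fun_prop⟩
  -- The height at time `s` is `t₁ (1 - s (1 - t₂))`. On CX it runs from `t` to `0`, on CA from `1`
  -- to `t`, and on the seam both formulas give `1 - s`. As the vertex of CX is at height `0` and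
  -- that of CA at height `1`, no reflection of the suspension coordinate appears.
  refine homotopic_of_surjective (mk A) surjective_mk
    ⟨fun z => Susp.mk X (x z.1, t₁ z.1 * unitInterval.symm (z.2 * unitInterval.symm (t₂ z.1))),
      by fun_prop⟩ ?_ ?_ ?_
  · rintro (p | p)
    · simp [toSusp_inl, x, t₁, t₂]
    · simp [toSusp_inr, x, t₁, t₂]
  · rintro (p | p)
    · exact Susp.mk_eq (.inr (.inl (by simp [t₁, t₂])))
    · simp [toSuspSub_inr, x, t₁, t₂, Susp.map_mk, incl]
  · have hlr : ∀ (p : X × unitInterval) (q : A × unitInterval) (s : unitInterval),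
        mk A (.inl p) = mk A (.inr q) →
        Susp.mk X (x (.inl p), t₁ (.inl p) * unitInterval.symm (s * unitInterval.symm (t₂ (.inl p))))
          = Susp.mk X (x (.inr q),
            t₁ (.inr q) * unitInterval.symm (s * unitInterval.symm (t₂ (.inr q)))) := by
      intro p q s e
      obtain ⟨e₁, e₂, e₃⟩ := inl_eq_inr.1 e
      simp [x, t₁, t₂, e₁, e₂, e₃]
    rintro (p | p) (q | q) s e
    · obtain rfl | e := inl_eq_inl.1 e
      · rfl
      · exact Susp.mk_eq (.inr (.inl (by simp [t₁, t₂, e])))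
    · exact hlr p q s e
    · exact (hlr q p s e.symm).symm
    · obtain rfl | e := inr_eq_inr.1 e
      · rfl
      · exact Susp.mk_eq (.inr (.inr (by simp [t₁, t₂, e])))

end DoubleCone

end Cones

/-! ### Contractible subspaces -/

section Contractible

variable {𝕜 : Type} [RCLike 𝕜] {X : Type u} [TopologicalSpace X] [CompactSpace X] [T2Space X]

theorem range_incl {X : Type u} [TopologicalSpace X] (A : Set X) : Set.range (incl A) = A := Subtype.range_val

/-- Collapsing a contractible closed subspace induces a bijection on isomorphism classes. -/
theorem Vect.bijective_map_mk {A : Set X} (hA : IsClosed A) (hc : ContractibleSpace A) (n : ℕ) :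
    Function.Bijective (Vect.map 𝕜 n (Collapse.mk A)) := by
  have := isCompact_iff_compactSpace.1 hA.isCompact
  have := Collapse.t2Space hA
  have hn := (contractible_iff_id_nullhomotopic A).1 hc
  obtain ⟨a, -⟩ := id hn
  have h := isCollapse_mk (incl A) Subtype.val_injective (range_incl A) a
  constructor
  · rintro ⟨E⟩ ⟨F⟩ hEF
    exact Quotient.sound (s := vectSetoid 𝕜 n _)
      (h.isIso_of_isIso_pullback hn E.1 F.1 (Quotient.exact (s := vectSetoid 𝕜 n X) hEF))
  · rintro ⟨E, hE⟩
    obtain ⟨m, hm⟩ := E.exists_isIso_trivial_of_nullhomotopic (f := incl A) (by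
      have := hn.comp_right (incl A)
      rwa [ContinuousMap.comp_id] at this)
    obtain ⟨F, ⟨e⟩⟩ := h.exists_isIso_pullback E hm
    refine ⟨Quotient.mk (vectSetoid 𝕜 n _) ⟨F, fun z => ?_⟩,
      Quotient.sound (s := vectSetoid 𝕜 n X) ⟨e⟩⟩
    obtain ⟨x, rfl⟩ := h.surjective z
    exact (e.equiv x).finrank_eq.trans (hE x)

end Contractible

/-! ### The long exact sequence -/

section LongExactSequence

variable {𝕜 : Type} [RCLike 𝕜] {X : Type u} [TopologicalSpace X] [CompactSpace X] [T2Space X]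
  {A : Set X} [Nonempty A]

variable (𝕜) in
-- The cone is contractible, and so are its iterated suspensions and those of the point onto which
-- it is collapsed.
theorem bijective_map_toCollapse (hA : IsClosed A) (n : ℕ) :
    Function.Bijective (RedK.map 𝕜 (IterSusp.map n (ConeAttach.toCollapse A))) := by
  have := isCompact_iff_compactSpace.1 hA.isCompact
  have := Collapse.t2Space hA
  have := ConeAttach.compactSpace hA
  have := ConeAttach.t2Space hA
  have : CompactSpace (Set.range (ConeAttach.inr A)) :=
    isCompact_iff_compactSpace.1 (isCompact_range (ConeAttach.inr A).continuous)
  exact ((ConeAttach.isCollapse_toCollapse A).iterSusp n).bijective_map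
    (IterSusp.id_nullhomotopic n ⟨(), .refl _⟩)
    (IterSusp.id_nullhomotopic n (ConeAttach.cone_nullhomotopic hA))

variable (𝕜) in
theorem exact_map_mk_map_incl (hA : IsClosed A) (n : ℕ) :
    Function.Exact (RedK.map 𝕜 (IterSusp.map n (Collapse.mk A)))
      (RedK.map 𝕜 (IterSusp.map n (incl A))) := by
  have := isCompact_iff_compactSpace.1 hA.isCompact
  have := Collapse.t2Space hA
  exact ((isCollapse_mk (incl A) Subtype.val_injective (range_incl A)
    (Classical.arbitrary A)).iterSusp n).exact_map (IterSusp.id_nullhomotopic n ⟨(), .refl _⟩)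

variable (𝕜) in
theorem exact_map_toSusp_map_inl (hA : IsClosed A) (n : ℕ) :
    Function.Exact (RedK.map 𝕜 (IterSusp.map n (ConeAttach.toSusp A)))
      (RedK.map 𝕜 (IterSusp.map n (ConeAttach.inl A))) := by
  have := isCompact_iff_compactSpace.1 hA.isCompact
  have := ConeAttach.compactSpace hA
  have := ConeAttach.t2Space hA
  exact ((ConeAttach.isCollapse_toSusp A).iterSusp n).exact_map
    (IterSusp.id_nullhomotopic n ⟨(), .refl _⟩)

variable (𝕜) in
-- The space CX ∪ CA stands in for SA: collapsing the contractible CX is invisible to K̃, whereas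
-- collapsing X ∪ CA gives SX and an exact sequence. The homotopy between the two maps to SX
-- identifies the map in that sequence with the suspended inclusion.
theorem exact_map_map_incl_map_toSusp (hA : IsClosed A) (n : ℕ) :
    Function.Exact (RedK.map 𝕜 (IterSusp.map n (Susp.map (incl A))))
      (RedK.map 𝕜 (IterSusp.map n (ConeAttach.toSusp A))) := by
  have := isCompact_iff_compactSpace.1 hA.isCompact
  have := ConeAttach.compactSpace hA
  have := ConeAttach.t2Space hA
  have := DoubleCone.compactSpace hA
  have := DoubleCone.t2Space hA
  have : CompactSpace (DoubleCone.lowerCone A) :=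
    isCompact_iff_compactSpace.1 (isCompact_range (by fun_prop))
  have hpt := IterSusp.id_nullhomotopic n (X := Unit) ⟨(), .refl _⟩
  intro z
  constructor
  · intro hz
    have hbij := ((DoubleCone.isCollapse_toSuspSub A).iterSusp n).bijective_map (𝕜 := 𝕜) hpt
      (IterSusp.id_nullhomotopic n (DoubleCone.lowerCone_nullhomotopic hA))
    have hex := ((DoubleCone.isCollapse_toSusp A).iterSusp n).exact_map (𝕜 := 𝕜) hpt
    obtain ⟨w, hw⟩ := (hex (RedK.map 𝕜 (IterSusp.map n (DoubleCone.toSuspSub A)) z)).1 (by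
      rw [← RedK.map_comp, ← IterSusp.map_comp, DoubleCone.toSuspSub_comp_ofConeAttach, hz])
    -- The equality is checked on CX ∪ CA, where pullback from SA is injective.
    refine ⟨w, hbij.1 ?_⟩
    rw [← hw, ← RedK.map_comp, ← IterSusp.map_comp]
    exact (DFunLike.congr_fun (RedK.map_eq_of_homotopic
      (IterSusp.map_homotopic n (DoubleCone.toSusp_homotopic hA))) w).symm
  · rintro ⟨w, rfl⟩
    rw [← RedK.map_comp, ← IterSusp.map_comp]
    exact RedK.map_eq_zero_of_nullhomotopic (IterSusp.map_nullhomotopic n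
      (ConeAttach.map_incl_comp_toSusp_nullhomotopic hA)) w

variable (𝕜) in
/-- The connecting homomorphism of the long exact sequence of a pair. -/
def connecting (hA : IsClosed A) (n : ℕ) :
    RedK 𝕜 (IterSusp n (Susp A)) →+ RedK 𝕜 (IterSusp n (Collapse A)) :=
  (AddEquiv.ofBijective (RedK.map 𝕜 (IterSusp.map n (ConeAttach.toCollapse A)))
    (bijective_map_toCollapse 𝕜 hA n)).symm.toAddMonoidHom.comp
    (RedK.map 𝕜 (IterSusp.map n (ConeAttach.toSusp A)))

theorem map_connecting (hA : IsClosed A) (n : ℕ) (z : RedK 𝕜 (IterSusp n (Susp A))) :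
    RedK.map 𝕜 (IterSusp.map n (ConeAttach.toCollapse A)) (connecting 𝕜 hA n z) =
      RedK.map 𝕜 (IterSusp.map n (ConeAttach.toSusp A)) z :=
  (AddEquiv.ofBijective _ (bijective_map_toCollapse 𝕜 hA n)).apply_symm_apply _

/-- Since `q` is the inclusion of X into X ∪ CA followed by `p`, this is exactness at X ∪ CA
transported through the bijection induced by `p`. -/
theorem exact_connecting_map_mk (hA : IsClosed A) (n : ℕ) :
    Function.Exact (connecting 𝕜 hA n) (RedK.map 𝕜 (IterSusp.map n (Collapse.mk A))) := by
  intro z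
  rw [← ConeAttach.toCollapse_comp_inl, IterSusp.map_comp, RedK.map_comp,
    exact_map_toSusp_map_inl 𝕜 hA n]
  refine exists_congr fun y => ?_
  rw [← map_connecting hA]
  exact (bijective_map_toCollapse 𝕜 hA n).1.eq_iff

theorem exact_map_incl_connecting (hA : IsClosed A) (n : ℕ) :
    Function.Exact (RedK.map 𝕜 (IterSusp.map n (Susp.map (incl A)))) (connecting 𝕜 hA n) := by
  intro z
  rw [← exact_map_map_incl_map_toSusp 𝕜 hA n z, ← map_connecting hA]
  exact (map_eq_zero_iff _ (bijective_map_toCollapse 𝕜 hA n).1).symm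

end LongExactSequence

/-! ### Wedge sums and products -/

section Products

variable {𝕜 : Type} [RCLike 𝕜]

/-- If collapsing `A` in `Y` gives `Z` and `Z → Y` is a section of the collapse, then a class on `Y`
is determined by its restrictions to `A` and `Z`. -/
theorem IsCollapse.eq_of_map_eq {A : Type u} [TopologicalSpace A] [CompactSpace A]
    {Y : Type v} [TopologicalSpace Y] [CompactSpace Y] [T2Space Y]
    {Z : Type w} [TopologicalSpace Z] [T2Space Z] {i : C(A, Y)} {f : C(Y, Z)} {j : C(Unit, Z)}
    (h : IsCollapse i f j) {g : C(Z, Y)} (hg : f.comp g = .id Z) (n : ℕ)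
    [CompactSpace Z] [T2Space A]
    {y y' : RedK 𝕜 (IterSusp n Y)}
    (h₁ : RedK.map 𝕜 (IterSusp.map n i) y = RedK.map 𝕜 (IterSusp.map n i) y')
    (h₂ : RedK.map 𝕜 (IterSusp.map n g) y = RedK.map 𝕜 (IterSusp.map n g) y') : y = y' := by
  rw [← sub_eq_zero, ← map_sub] at h₁ h₂
  rw [← sub_eq_zero]
  -- The difference of the classes dies on `A`, so it is pulled back from some `z` on `Z`;
  -- restriction along the section returns `z`, which therefore vanishes.
  obtain ⟨z, hz⟩ := ((h.iterSusp n).exact_map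
    (IterSusp.id_nullhomotopic n ⟨(), .refl _⟩) (y - y')).1 h₁
  rw [← hz, ← RedK.map_comp, ← IterSusp.map_comp, hg, IterSusp.map_id, RedK.map_id] at h₂
  rw [← hz, h₂, map_zero]

theorem RedK.map_const_eq_zero {X : Type u} [TopologicalSpace X] [CompactSpace X]
    {Y : Type v} [TopologicalSpace Y] [CompactSpace Y] [T2Space Y] (n : ℕ) [T2Space X] (y : Y)
    (a : RedK 𝕜 (IterSusp n Y)) : RedK.map 𝕜 (IterSusp.map n (.const X y)) a = 0 :=
  RedK.map_eq_zero_of_nullhomotopic (IterSusp.map_nullhomotopic n ⟨y, .refl _⟩) a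

/-! ### Wedge sums -/

section Wedge

variable {A : Type u} [TopologicalSpace A] {B : Type v} [TopologicalSpace B] (a₀ : A) (b₀ : B)

namespace Wedge

/-- The map `A ∨ B → A` that collapses `B`. -/
def fst : C(Wedge a₀ b₀, A) where
  toFun := Quotient.lift (Sum.elim id fun _ => a₀) (by
    rintro (x | x) (y | y) (h | h) <;> simp_all)
  continuous_toFun := Continuous.quotient_lift (by fun_prop) _

/-- The map `A ∨ B → B` that collapses `A`. -/
def snd : C(Wedge a₀ b₀, B) where
  toFun := Quotient.lift (Sum.elim (fun _ => b₀) id) (by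
    rintro (x | x) (y | y) (h | h) <;> simp_all)
  continuous_toFun := Continuous.quotient_lift (by fun_prop) _

theorem fst_comp_inl : (fst a₀ b₀).comp (inl a₀ b₀) = .id A := rfl

theorem fst_comp_inr : (fst a₀ b₀).comp (inr a₀ b₀) = .const B a₀ := rfl

theorem snd_comp_inl : (snd a₀ b₀).comp (inl a₀ b₀) = .const A b₀ := rfl

theorem snd_comp_inr : (snd a₀ b₀).comp (inr a₀ b₀) = .id B := rfl

theorem inl_eq_inr : inl a₀ b₀ a₀ = inr a₀ b₀ b₀ := Collapse.mk_eq (.inr (by simp))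

theorem eq_inl_or_inr (w : Wedge a₀ b₀) : (∃ a, w = inl a₀ b₀ a) ∨ ∃ b, w = inr a₀ b₀ b := by
  obtain ⟨a | b, rfl⟩ := Collapse.surjective_mk _ w
  exacts [.inl ⟨a, rfl⟩, .inr ⟨b, rfl⟩]

theorem isCollapse_snd : IsCollapse (inl a₀ b₀) (snd a₀ b₀) (.const Unit b₀) where
  injective_incl := (show Function.LeftInverse (fst a₀ b₀) (inl a₀ b₀) from fun _ => rfl).injective
  surjective b := ⟨inr a₀ b₀ b, rfl⟩
  injective_center _ _ _ := rfl
  mem_range_iff w := by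
    obtain ⟨a, rfl⟩ | ⟨b, rfl⟩ := eq_inl_or_inr a₀ b₀ w
    · exact ⟨fun _ => ⟨a, rfl⟩, fun _ => ⟨(), rfl⟩⟩
    · constructor
      · rintro ⟨⟨⟩, h : b₀ = b⟩
        exact ⟨a₀, h ▸ inl_eq_inr a₀ b₀⟩
      · rintro ⟨a, h⟩
        exact ⟨(), congrArg (snd a₀ b₀) h⟩
  eq_or w w' h := by
    obtain ⟨a, rfl⟩ | ⟨b, rfl⟩ := eq_inl_or_inr a₀ b₀ w <;>
      obtain ⟨a', rfl⟩ | ⟨b', rfl⟩ := eq_inl_or_inr a₀ b₀ w'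
    · exact .inr ⟨⟨_, rfl⟩, ⟨_, rfl⟩⟩
    · obtain rfl : b₀ = b' := h
      exact .inr ⟨⟨_, rfl⟩, ⟨_, inl_eq_inr a₀ b₀⟩⟩
    · obtain rfl : b = b₀ := h
      exact .inr ⟨⟨_, inl_eq_inr a₀ b⟩, ⟨_, rfl⟩⟩
    · obtain rfl : b = b' := h
      exact .inl rfl

end Wedge

variable [CompactSpace A] [T2Space A] [CompactSpace B] [T2Space B]

/-- The reduced K-group of a wedge sum. -/
theorem exists_wedge_equiv : ∃ e : RedK 𝕜 (Wedge a₀ b₀) ≃+ RedK 𝕜 A × RedK 𝕜 B,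
    ∀ z, e z = (RedK.map 𝕜 (Wedge.inl a₀ b₀) z, RedK.map 𝕜 (Wedge.inr a₀ b₀) z) := by
  have := Wedge.t2Space a₀ b₀
  refine ⟨AddEquiv.ofBijective ((RedK.map 𝕜 (Wedge.inl a₀ b₀)).prod
    (RedK.map 𝕜 (Wedge.inr a₀ b₀))) ⟨fun z z' h => ?_, fun ⟨a, b⟩ => ?_⟩, fun z => rfl⟩
  · exact (Wedge.isCollapse_snd a₀ b₀).eq_of_map_eq (Wedge.snd_comp_inr a₀ b₀) 0
      (congrArg Prod.fst h) (congrArg Prod.snd h)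
  -- The retractions give the preimage; the cross terms are pullbacks along constant maps and
  -- vanish.
  · refine ⟨RedK.map 𝕜 (Wedge.fst a₀ b₀) a + RedK.map 𝕜 (Wedge.snd a₀ b₀) b, ?_⟩
    have h₁ : RedK.map 𝕜 (.const B a₀) a = 0 := RedK.map_const_eq_zero 0 a₀ a
    have h₂ : RedK.map 𝕜 (.const A b₀) b = 0 := RedK.map_const_eq_zero 0 b₀ b
    refine Prod.ext ?_ ?_
    · change RedK.map 𝕜 (Wedge.inl a₀ b₀) _ = a
      rw [map_add, ← RedK.map_comp, ← RedK.map_comp, Wedge.fst_comp_inl, Wedge.snd_comp_inl,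
        RedK.map_id, h₂, add_zero]
    · change RedK.map 𝕜 (Wedge.inr a₀ b₀) _ = b
      rw [map_add, ← RedK.map_comp, ← RedK.map_comp, Wedge.fst_comp_inr, Wedge.snd_comp_inr,
        RedK.map_id, h₁, zero_add]

end Wedge

/-! ### Smash products and products -/

section Smash

variable {X : Type u} [TopologicalSpace X] {Y : Type v} [TopologicalSpace Y] (x₀ : X) (y₀ : Y)

/-- The union of the axes in `X × Y`. -/
abbrev axes : Set (X × Y) := {p | p.2 = y₀ ∨ p.1 = x₀}

/-- The inclusion of the first axis in the union of the axes. -/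
def axes.inl : C(X, axes x₀ y₀) := ⟨fun x => ⟨(x, y₀), Or.inl rfl⟩, by fun_prop⟩

/-- The inclusion of the second axis in the union of the axes. -/
def axes.inr : C(Y, axes x₀ y₀) := ⟨fun y => ⟨(x₀, y), Or.inr rfl⟩, by fun_prop⟩

/-- The union of the axes is treated as a wedge through this collapse and its section `axes.inr`,
without a homeomorphism with `Wedge`. -/
theorem axes.isCollapse_snd : IsCollapse (axes.inl x₀ y₀)
    ((ContinuousMap.snd : C(X × Y, Y)).comp (incl (axes x₀ y₀))) (.const Unit y₀) where
  injective_incl x x' h := congrArg (fun p => p.1.1) h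
  surjective y := ⟨axes.inr x₀ y₀ y, rfl⟩
  injective_center _ _ _ := rfl
  mem_range_iff := by
    rintro ⟨⟨x, y⟩, hp⟩
    constructor
    · rintro ⟨⟨⟩, h : y₀ = y⟩
      exact ⟨x, Subtype.ext (Prod.ext rfl h)⟩
    · rintro ⟨x, h⟩
      exact ⟨(), congrArg (fun p => p.1.2) h⟩
  eq_or := by
    rintro ⟨⟨x, y⟩, hp⟩ ⟨⟨x', y'⟩, hp'⟩ h
    obtain rfl : y = y' := h
    by_cases hy : y = y₀
    · exact .inr ⟨⟨x, Subtype.ext (Prod.ext rfl hy.symm)⟩,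
        ⟨x', Subtype.ext (Prod.ext rfl hy.symm)⟩⟩
    · obtain rfl : x = x₀ := hp.resolve_left hy
      obtain rfl : x' = x := hp'.resolve_left hy
      exact .inl rfl

theorem isClosed_axes [T2Space X] [T2Space Y] : IsClosed (axes x₀ y₀) :=
  (isClosed_eq continuous_snd continuous_const).union (isClosed_eq continuous_fst continuous_const)

variable [CompactSpace X] [T2Space X] [CompactSpace Y] [T2Space Y]

/-- Classes on the iterated suspensions of the union of the axes extend to those of `X × Y`. -/
theorem map_fst_add_map_snd_restrict_axes (n : ℕ) (z : RedK 𝕜 (IterSusp n (axes x₀ y₀))) :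
    RedK.map 𝕜 (IterSusp.map n (incl (axes x₀ y₀)))
      (RedK.map 𝕜 (IterSusp.map n ContinuousMap.fst)
          (RedK.map 𝕜 (IterSusp.map n (axes.inl x₀ y₀)) z) +
        RedK.map 𝕜 (IterSusp.map n ContinuousMap.snd)
          (RedK.map 𝕜 (IterSusp.map n (axes.inr x₀ y₀)) z)) = z := by
  have := isCompact_iff_compactSpace.1 (isClosed_axes x₀ y₀).isCompact
  refine (axes.isCollapse_snd x₀ y₀).eq_of_map_eq (g := axes.inr x₀ y₀) rfl n ?_ ?_
  · simp only [map_add, ← RedK.map_comp, ← IterSusp.map_comp]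
    change RedK.map 𝕜 (IterSusp.map n (axes.inl x₀ y₀)) z +
      RedK.map 𝕜 (IterSusp.map n (.const X (axes.inr x₀ y₀ y₀))) z = _
    rw [RedK.map_const_eq_zero, add_zero]
  · simp only [map_add, ← RedK.map_comp, ← IterSusp.map_comp]
    change RedK.map 𝕜 (IterSusp.map n (.const Y (axes.inl x₀ y₀ x₀))) z +
      RedK.map 𝕜 (IterSusp.map n (axes.inr x₀ y₀)) z = _
    rw [RedK.map_const_eq_zero, zero_add]

/-- By exactness the kernel is the image of the connecting map. That map is zero because restriction
from S(X × Y) to the suspended axes is surjective, which is the extension result for `n = 1`. -/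
theorem injective_map_smash : Function.Injective (RedK.map 𝕜 (Smash.mk x₀ y₀)) := by
  have := Smash.t2Space x₀ y₀
  have hcl := isClosed_axes x₀ y₀
  have : Nonempty (axes x₀ y₀) := ⟨axes.inl x₀ y₀ x₀⟩
  refine (injective_iff_map_eq_zero _).2 fun c hc => ?_
  obtain ⟨z, rfl⟩ := (exact_connecting_map_mk (𝕜 := 𝕜) hcl 0 c).1 hc
  exact (exact_map_incl_connecting hcl 0 z).2
    ⟨_, map_fst_add_map_snd_restrict_axes x₀ y₀ 1 z⟩

/-- The reduced K-group of a product. -/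
theorem exists_smash_equiv :
    ∃ e : RedK 𝕜 (Smash x₀ y₀) × RedK 𝕜 X × RedK 𝕜 Y ≃+ RedK 𝕜 (X × Y),
      ∀ c a b, e (c, a, b) = RedK.map 𝕜 (Smash.mk x₀ y₀) c + RedK.map 𝕜 ContinuousMap.fst a +
        RedK.map 𝕜 ContinuousMap.snd b := by
  have := Smash.t2Space x₀ y₀
  have : Nonempty (axes x₀ y₀) := ⟨axes.inl x₀ y₀ x₀⟩
  let Φ : RedK 𝕜 (Smash x₀ y₀) × RedK 𝕜 X × RedK 𝕜 Y →+ RedK 𝕜 (X × Y) :=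
    (RedK.map 𝕜 (Smash.mk x₀ y₀)).coprod
      ((RedK.map 𝕜 ContinuousMap.fst).coprod (RedK.map 𝕜 ContinuousMap.snd))
  have hΦ : ∀ c a b, Φ (c, a, b) = RedK.map 𝕜 (Smash.mk x₀ y₀) c +
      (RedK.map 𝕜 ContinuousMap.fst a + RedK.map 𝕜 ContinuousMap.snd b) := fun _ _ _ => rfl
  have := isCompact_iff_compactSpace.1 (isClosed_axes x₀ y₀).isCompact
  have hex : Function.Exact (RedK.map 𝕜 (Smash.mk x₀ y₀)) (RedK.map 𝕜 (incl (axes x₀ y₀))) :=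
    exact_map_mk_map_incl 𝕜 (isClosed_axes x₀ y₀) 0
  have hsplit (w : RedK 𝕜 (axes x₀ y₀)) : RedK.map 𝕜 (incl (axes x₀ y₀))
      (RedK.map 𝕜 ContinuousMap.fst (RedK.map 𝕜 (axes.inl x₀ y₀) w) +
        RedK.map 𝕜 ContinuousMap.snd (RedK.map 𝕜 (axes.inr x₀ y₀) w)) = w :=
    map_fst_add_map_snd_restrict_axes x₀ y₀ 0 w
  refine ⟨AddEquiv.ofBijective Φ ⟨(injective_iff_map_eq_zero Φ).2 ?_, fun z => ?_⟩,
    fun c a b => (hΦ c a b).trans (add_assoc _ _ _).symm⟩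
  · rintro ⟨c, a, b⟩ h
    -- Restriction to the axes kills the contribution of `c`; further restriction to each axis
    -- isolates `a` and `b`.
    have hi : RedK.map 𝕜 (incl (axes x₀ y₀)) (Φ (c, a, b)) = 0 := by rw [h, map_zero]
    have hc : RedK.map 𝕜 (incl (axes x₀ y₀)) (RedK.map 𝕜 (Smash.mk x₀ y₀) c) = 0 :=
      (hex _).2 ⟨c, rfl⟩
    rw [hΦ, map_add, hc, zero_add, map_add] at hi
    have ha : a = 0 := by
      have := congrArg (RedK.map 𝕜 (axes.inl x₀ y₀)) hi
      simp only [map_add, ← RedK.map_comp, map_zero] at this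
      rw [← this, ← RedK.map_id a]
      nth_rewrite 1 [← add_zero (RedK.map 𝕜 _ a)]
      refine congrArg₂ (· + ·) (by rw [RedK.map_id]; exact (RedK.map_id a).symm)
        (RedK.map_const_eq_zero (X := X) 0 y₀ b).symm
    have hb : b = 0 := by
      have := congrArg (RedK.map 𝕜 (axes.inr x₀ y₀)) hi
      simp only [ha, map_zero, zero_add, ← RedK.map_comp] at this
      rw [← this]
      exact (RedK.map_id b).symm
    rw [ha, hb, hΦ, map_zero, map_zero, add_zero, add_zero, ← map_zero (RedK.map 𝕜 (Smash.mk x₀ y₀))]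
      at h
    rw [ha, hb, injective_map_smash x₀ y₀ h]
    rfl
  · let w := RedK.map 𝕜 (incl (axes x₀ y₀)) z
    have hw := hsplit w
    let a := RedK.map 𝕜 (axes.inl x₀ y₀) w
    let b := RedK.map 𝕜 (axes.inr x₀ y₀) w
    -- After the part of `z` seen on the axes is subtracted, the remainder restricts to zero there
    -- and so comes from the smash product.
    obtain ⟨c, hc⟩ := (hex (z - (RedK.map 𝕜 ContinuousMap.fst a +
      RedK.map 𝕜 ContinuousMap.snd b))).1 ((map_sub _ _ _).trans (sub_eq_zero.2 hw.symm))
    refine ⟨(c, a, b), ?_⟩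
    rw [hΦ]
    exact (congrArg (· + _) hc).trans (sub_add_cancel _ _)

end Smash

end Products

end

end KTheory

theorem mainTheorem3 (𝕜 : Type) [RCLike 𝕜] :
    -- for compact Hausdorff spaces the sets of stable classes are abelian groups
    (∀ (Z : Type u) [TopologicalSpace Z] [CompactSpace Z] [T2Space Z] (a : KTheory.RedK 𝕜 Z),
      ∃ b : KTheory.RedK 𝕜 Z, a + b = 0) ∧
    -- collapsing a contractible closed subspace
    (∀ (X : Type u) [TopologicalSpace X] [CompactSpace X] [T2Space X] (A : Set X),
      IsClosed A → ContractibleSpace A → ∀ n : ℕ,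
        Function.Bijective (KTheory.Vect.map 𝕜 n (KTheory.Collapse.mk A))) ∧
    -- the long exact sequence of the pair `(X, A)`
    (∀ (X : Type u) [TopologicalSpace X] [CompactSpace X] [T2Space X] (A : Set X) [Nonempty A],
      IsClosed A →
      (∀ n : ℕ, Function.Bijective
        (KTheory.RedK.map 𝕜 (KTheory.IterSusp.map n (KTheory.ConeAttach.toCollapse A)))) ∧
      ∃ δ : ∀ n : ℕ, KTheory.RedK 𝕜 (KTheory.IterSusp (n + 1) A) →+
          KTheory.RedK 𝕜 (KTheory.IterSusp n (KTheory.Collapse A)),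
        ∀ n : ℕ,
          -- `δ n` is induced by the two quotient maps `X ∪ CA → X / A` and `X ∪ CA → SA`
          (∀ z : KTheory.RedK 𝕜 (KTheory.IterSusp (n + 1) A),
            KTheory.RedK.map 𝕜 (KTheory.IterSusp.map n (KTheory.ConeAttach.toCollapse A)) (δ n z) =
              KTheory.RedK.map 𝕜 (KTheory.IterSusp.map n (KTheory.ConeAttach.toSusp A)) z) ∧
          -- exactness at `K̃(SⁿX)`, at `K̃(Sⁿ(X / A))` and at `K̃(Sⁿ⁺¹A)`
          Function.Exact
            (KTheory.RedK.map 𝕜 (KTheory.IterSusp.map n (KTheory.Collapse.mk A)))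
            (KTheory.RedK.map 𝕜 (KTheory.IterSusp.map n (KTheory.incl A))) ∧
          Function.Exact (δ n)
            (KTheory.RedK.map 𝕜 (KTheory.IterSusp.map n (KTheory.Collapse.mk A))) ∧
          Function.Exact
            (KTheory.RedK.map 𝕜 (KTheory.IterSusp.map (n + 1) (KTheory.incl A))) (δ n)) ∧
    -- wedge sums
    (∀ (A : Type u) [TopologicalSpace A] [CompactSpace A] [T2Space A]
      (B : Type v) [TopologicalSpace B] [CompactSpace B] [T2Space B] (a₀ : A) (b₀ : B),
      ∃ e : KTheory.RedK 𝕜 (KTheory.Wedge a₀ b₀) ≃+ KTheory.RedK 𝕜 A × KTheory.RedK 𝕜 B,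
        ∀ z, e z = (KTheory.RedK.map 𝕜 (KTheory.Wedge.inl a₀ b₀) z,
          KTheory.RedK.map 𝕜 (KTheory.Wedge.inr a₀ b₀) z)) ∧
    -- products
    (∀ (X : Type u) [TopologicalSpace X] [CompactSpace X] [T2Space X]
      (Y : Type v) [TopologicalSpace Y] [CompactSpace Y] [T2Space Y] (x₀ : X) (y₀ : Y),
      ∃ e : KTheory.RedK 𝕜 (KTheory.Smash x₀ y₀) × KTheory.RedK 𝕜 X × KTheory.RedK 𝕜 Y ≃+
          KTheory.RedK 𝕜 (X × Y),
        ∀ c a b, e (c, a, b) = KTheory.RedK.map 𝕜 (KTheory.Smash.mk x₀ y₀) c +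
          KTheory.RedK.map 𝕜 ContinuousMap.fst a + KTheory.RedK.map 𝕜 ContinuousMap.snd b) := by
  exact ⟨fun Z _ _ _ a => KTheory.RedK.exists_add_eq_zero a,
    fun X _ _ _ A hA hc n => KTheory.Vect.bijective_map_mk hA hc n,
    fun X _ _ _ A _ hA => ⟨KTheory.bijective_map_toCollapse 𝕜 hA,
      fun n => KTheory.connecting 𝕜 hA n, fun n => ⟨KTheory.map_connecting hA n,
        KTheory.exact_map_mk_map_incl 𝕜 hA n, KTheory.exact_connecting_map_mk hA n,
        KTheory.exact_map_incl_connecting hA n⟩⟩,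
    fun A _ _ _ B _ _ _ a₀ b₀ => KTheory.exists_wedge_equiv a₀ b₀,
    fun X _ _ _ Y _ _ _ x₀ y₀ => KTheory.exists_smash_equiv x₀ y₀⟩
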